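/- There is a universal constant $C>0$ with the following property. Let $L$ be a number of layers, let $d_1^0,d_1^1,\dots,d_1^L$ be widths ($d_1^0$ is the input dimension), and let $d_2^l=d_1^{l-1}$. Let $d>0$ and $\Psi>0$. The weight matrices $\mathbf A^l\in\mathbb R^{d_1^l\times d_2^l}$, $l=1,\dots,L$, have entries that are i.i.d. $\mathcal N(0,\Psi)$ (over all entries of all layers). Given the weights, the pruned matrices $\hat{\mathbf A}^l$ are obtained by setting each off-diagonal entry $\mathbf A^l_{ij}$, $i\ne j$, independently to $0$ with probability $\exp(-(\mathbf A^l_{ij})^2/(d\Psi))$ and keeping it otherwise; diagonal entries are kept. Let $\phi_1,\dots,\phi_{L-1}$ be activation maps on $\mathbb R^{d_1^1},\dots,\mathbb R^{d_1^{L-1}}$ such that $\phi_l$ is $L_l$-Lipschitz for the Euclidean norm and $\phi_l(0)=0$; the output layer has no activation, and $L_L\ge 1$ is any Lipschitz constant of the identity. For an input $x$ put $x^0=x$, $x^1=\mathbf A^1x$, $x^{l+1}=\mathbf A^{l+1}\phi_l(x^l)$, and let $\hat x^l$ be the same with $\hat{\mathbf A}^l$ in place of $\mathbf A^l$. Let $\|\cdot\|_2$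 be the Euclidean norm of vectors and the spectral norm of matrices, and $$\Gamma_l=C\left[\sqrt{\frac{d^{3/2}\Psi}{(d+2)^{3/2}}}\left(\sqrt{d_1^l}+\sqrt{d_2^l}\right)+\left(\frac{3d_1^ld_2^ld^{5/2}\Psi^2}{(d+2)^{5/2}}\right)^{1/4}\right].$$ Let $\epsilon_1,\dots,\epsilon_L>0$, and consider the bound $$\|\hat x^L-x^L\|_2\le e\,d_1^0\left(\prod_{l=1}^L L_l\|\mathbf A^l\|_2\right)\sum_{l=1}^L\frac{\epsilon_l\Gamma_l}{\|\mathbf A^l\|_2}.\qquad(*)$$ (a) For every input $x$ with $\|x\|_2\le d_1^0$, the bound $(*)$ holds with probability at least $1-\sum_{l=1}^L\epsilon_l^{-1}$ over the weights and the pruning. (b) With probability at least $1-\sum_{l=1}^L\epsilon_l^{-1}$, the following holds: if $\epsilon_l\Gamma_l\le\frac1L\|\mathbf A^l\|_2$ for all $l$, then $(*)$ holds simultaneously for all inputs $x$ with $\|x\|_2\le d_1^0$. -/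

import Mathlib

open MeasureTheory ProbabilityTheory
open scoped NNReal ENNReal unitInterval

noncomputable section

namespace MBP

/-- Vectors of length `m` with the Euclidean norm. -/
abbrev Vec (m : ℕ) : Type := EuclideanSpace ℝ (Fin m)

/-- Positions of all the scalar weights of a network with `L` layers and widths `n 0, …, n L`
(`n 0` is the input dimension).  The `l`-th matrix (`l = 0, …, L - 1`) has `n (l + 1)` rows and
`n l` columns. -/
abbrev Entry (L : ℕ) (n : ℕ → ℕ) : Type := Σ l : Fin L, Fin (n (l + 1)) × Fin (n l)

/-- A choice of all the weights. -/
abbrev Weights (L : ℕ) (n : ℕ → ℕ) : Type := Entry L n → ℝ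

/-- The outcomes of the coin flips of the pruning algorithm, one for each weight. -/
abbrev Coins (L : ℕ) (n : ℕ → ℕ) : Type := Entry L n → Bool

variable {L : ℕ} {n : ℕ → ℕ}

/-- The weight matrix of layer `l`. -/
def layer (w : Weights L n) (l : Fin L) : Matrix (Fin (n (l + 1))) (Fin (n l)) ℝ :=
  Matrix.of fun i j => w ⟨l, (i, j)⟩

/-- The spectral norm, i.e. the operator norm with respect to the Euclidean norms. -/
def specNorm {p q : ℕ} (A : Matrix (Fin p) (Fin q) ℝ) : ℝ :=
  ‖LinearMap.toContinuousLinearMap (Matrix.toEuclideanLin A)‖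

/-- The vectors `x⁰ = x`, `x¹ = A₁ x`, `xˡ⁺¹ = Aₗ₊₁ φₗ(xˡ)`.  Layers and activations are indexed from
`0` here, so `φ l` is applied to the output of the matrix `layer w l`; the last activation is never
used. -/
def forward (w : Weights L n) (φ : ∀ l : Fin L, Vec (n (l + 1)) → Vec (n (l + 1)))
    (x : Vec (n 0)) : ∀ l : ℕ, l ≤ L → Vec (n l)
  | 0, _ => x
  | 1, h => Matrix.toEuclideanLin (layer w ⟨0, h⟩) x
  | l + 2, h =>
      Matrix.toEuclideanLin (layer w ⟨l + 1, h⟩)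
        (φ ⟨l, Nat.lt_of_succ_lt h⟩ (forward w φ x (l + 1) (Nat.le_of_succ_le h)))

/-- The output `A_L φ_{L-1}(A_{L-1} φ_{L-2}(⋯ φ₁(A₁ x)))` of the network. -/
def output (w : Weights L n) (φ : ∀ l : Fin L, Vec (n (l + 1)) → Vec (n (l + 1)))
    (x : Vec (n 0)) : Vec (n L) :=
  forward w φ x L le_rfl

/-- The law of the trained weights: all entries of all layers are i.i.d. `N(0, Ψ)`. -/
def weightLaw (L : ℕ) (n : ℕ → ℕ) (Ψ : ℝ≥0) : Measure (Weights L n) :=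
  Measure.pi fun _ => gaussianReal 0 Ψ

/-- The probability `exp (-a² / (d Ψ))` with which an off-diagonal weight of value `a` is pruned. -/
def pruneProb (d Ψ : ℝ≥0) (a : ℝ) : I :=
  ⟨Real.exp (-a ^ 2 / (d * Ψ)), (Real.exp_pos _).le, Real.exp_le_one_iff.2
    (div_nonpos_of_nonpos_of_nonneg (neg_nonpos.2 (sq_nonneg a)) (mul_nonneg d.2 Ψ.2))⟩

/-- The law of the coins given the weights: independent, the coin of an entry of value `a` being
`true` with probability `pruneProb d Ψ a`. -/
def coinLaw (d Ψ : ℝ≥0) (w : Weights L n) : Measure (Coins L n) :=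
  Measure.pi fun e => bernoulliMeasure true false (pruneProb d Ψ (w e))

lemma measurable_pruneProb (d Ψ : ℝ≥0) : Measurable (pruneProb d Ψ) := by
  unfold pruneProb
  exact Measurable.subtype_mk (by fun_prop)

lemma measurable_bernoulli_pruneProb (d Ψ : ℝ≥0) :
    Measurable fun a : ℝ => bernoulliMeasure true false (pruneProb d Ψ a) := by
  refine Measure.measurable_of_measurable_coe _ fun s hs => ?_
  classical
  have h := measurable_pruneProb d Ψ
  have h1 : Measurable fun a => (unitInterval.toNNReal (pruneProb d Ψ a) : ℝ≥0∞) :=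
    (unitInterval.toNNReal_continuous.measurable.comp h).coe_nnreal_ennreal
  have h2 : Measurable fun a => (unitInterval.toNNReal (σ (pruneProb d Ψ a)) : ℝ≥0∞) :=
    (unitInterval.toNNReal_continuous.measurable.comp
      (unitInterval.continuous_symm.measurable.comp h)).coe_nnreal_ennreal
  simp only [bernoulliMeasure_apply _ hs]
  split_ifs <;> first | exact measurable_const | exact h1 | exact h2

instance (d Ψ : ℝ≥0) (w : Weights L n) : IsProbabilityMeasure (coinLaw d Ψ w) := by
  unfold coinLaw; infer_instance

lemma measurable_coinLaw (d Ψ : ℝ≥0) : Measurable (coinLaw (L := L) (n := n) d Ψ) := by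
  refine Measurable.measure_of_isPiSystem_of_isProbabilityMeasure generateFrom_pi.symm
    isPiSystem_pi ?_
  rintro _ ⟨s, hs, rfl⟩
  simp only [coinLaw, Measure.pi_pi]
  refine Finset.measurable_prod _ fun e _ => ?_
  have he : MeasurableSet (s e) := hs e (Set.mem_univ e)
  exact (Measure.measurable_coe he).comp
    ((measurable_bernoulli_pruneProb d Ψ).comp (measurable_pi_apply e))

/-- `coinLaw` as a Markov kernel. -/
def coinKernel (L : ℕ) (n : ℕ → ℕ) (d Ψ : ℝ≥0) : Kernel (Weights L n) (Coins L n) where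
  toFun := coinLaw d Ψ
  measurable' := measurable_coinLaw d Ψ

instance (d Ψ : ℝ≥0) : IsMarkovKernel (coinKernel L n d Ψ) :=
  ⟨fun w => inferInstanceAs (IsProbabilityMeasure (coinLaw d Ψ w))⟩

/-- The joint law of the trained weights and of the coins of the pruning algorithm. -/
def jointLaw (L : ℕ) (n : ℕ → ℕ) (d Ψ : ℝ≥0) : Measure (Weights L n × Coins L n) :=
  weightLaw L n Ψ ⊗ₘ coinKernel L n d Ψ

/-- The result of magnitude-based pruning: an off-diagonal entry is set to `0` if its coin is
`true`; all other entries, in particular the diagonal ones, are kept. -/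
def prune (w : Weights L n) (X : Coins L n) : Weights L n := fun e =>
  if (e.2.1 : ℕ) ≠ (e.2.2 : ℕ) ∧ X e = true then 0 else w e

/-- `Γ` for a layer with a `d₁ × d₂` matrix. -/
def Gam (C : ℝ) (d Ψ : ℝ≥0) (d₁ d₂ : ℕ) : ℝ :=
  C * (Real.sqrt ((d : ℝ) ^ (3 / 2 : ℝ) * Ψ / ((d : ℝ) + 2) ^ (3 / 2 : ℝ)) *
        (Real.sqrt d₁ + Real.sqrt d₂) +
      (3 * d₁ * d₂ * (d : ℝ) ^ (5 / 2 : ℝ) * (Ψ : ℝ) ^ 2 / ((d : ℝ) + 2) ^ (5 / 2 : ℝ)) ^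
        (1 / 4 : ℝ))

/-- The bound `e d₁⁰ (∏ₗ Lₗ ‖Aˡ‖₂) ∑ₗ εₗ Γₗ / ‖Aˡ‖₂`, with `d₁⁰ = n 0` the input dimension. -/
def errorBound (C : ℝ) (d Ψ : ℝ≥0) (ε : Fin L → ℝ) (Lip : Fin L → ℝ≥0) (w : Weights L n) : ℝ :=
  Real.exp 1 * (n 0 : ℝ) * (∏ l : Fin L, (Lip l : ℝ) * specNorm (layer w l)) *
    ∑ l : Fin L, ε l * Gam C d Ψ (n (l + 1)) (n l) / specNorm (layer w l)

end MBP

end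

namespace MBP

variable {L : ℕ} {n : ℕ → ℕ}

/-! Write `R_l` for the part of the matrix `A_l` that pruning removes, `û_l` for the input of layer
`l` in the pruned network, and `G_l` for the product of `Lip k * ‖A_k‖` over `k < l`. Since the
pruned matrix is `A_l - R_l`, the output error telescopes: if `‖R_l û_l‖ ≤ e n₀ ε_l Γ_l G_l` for all
`l`, the error bound follows (`norm_act_prune_sub_le`, `norm_output_sub_le_errorBound`). Both claims
reduce to these layer errors, through Markov's inequality and a union bound over the layers.

The probabilistic core is `E ‖R_l‖ ≤ Γ_l` (`lintegral_specNorm_removed_le`). The Gaussian density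
times the pruning probability is a multiple of a narrower Gaussian density. So an off-diagonal entry
is removed with probability `p = sqrt (d/(d+2))`, and given this it is Gaussian of variance `s =
dΨ/(d+2)`. Every bilinear form of `R_l` thus has an explicit exponential moment, normalised to 1.
Integrating it over Gaussian test vectors and changing their law to one centred at an arbitrary pair
of vectors of norm at most 1 (a PAC-Bayes argument) controls all such pairs at once, hence the
spectral norm. What remains are row sums, column sums and the total sum of the coins, for which
first and second moments suffice.

For the uniform claim, the event `‖R_l‖ ≤ ε_l Γ_l` for all `l`, together with the perturbation
condition, makes each pruned matrix at most `(1 + 1/L)‖A_l‖` in norm. So `û_l` is at most `(1 +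
1/L)^l ≤ e` times `G_l ‖x‖`, for every input at once.

For a fixed input no such condition is available, and sign symmetry replaces it. The joint law is
invariant under sign changes of the weights, because pruning sees only squares. Averaging over the
signs of a layer bounds the mean of `‖A v‖` by the largest column norm of `A` times `‖v‖`. Pruning
does not increase column norms, sign changes preserve them, and they are at most the spectral norm
of every re-signed matrix. Hence `‖û_l‖ / G_l` does not grow on average with `l`, and `E (‖R_l û_l‖
/ G_l) ≤ ‖x‖ E ‖R_l‖` (`lintegral_error_div_gain_le`). -/

/-! ### Gaussian shifts and the variational lower bound -/

lemma lintegral_pi_prod {ι : Type*} [Fintype ι] {E : ι → Type*} {mE : ∀ i, MeasurableSpace (E i)}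
    (μ : ∀ i, Measure (E i)) [∀ i, IsProbabilityMeasure (μ i)] (f : ∀ i, E i → ℝ≥0∞)
    (hf : ∀ i, Measurable (f i)) :
    ∫⁻ x, ∏ i, f i (x i) ∂Measure.pi μ = ∏ i, ∫⁻ x, f i x ∂μ i := by
  have h := iIndepFun_pi (μ := μ) (X := f) (fun i => (hf i).aemeasurable)
  have h2 := lintegral_prod_eq_prod_lintegral_of_indepFun Finset.univ _ h
    (fun i => (hf i).comp (measurable_pi_apply i))
  rw [h2]
  exact Finset.prod_congr rfl fun i _ =>
    (measurePreserving_eval μ i).lintegral_comp (hf i)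

/-- Jensen's inequality for the exponential, without an integrability assumption on `exp ∘ g`. -/
lemma ofReal_exp_integral_le {Ω : Type*} [MeasurableSpace Ω] {μ : Measure Ω}
    [IsProbabilityMeasure μ] {g : Ω → ℝ} (hg : Integrable g μ) :
    ENNReal.ofReal (Real.exp (∫ x, g x ∂μ)) ≤ ∫⁻ x, ENNReal.ofReal (Real.exp (g x)) ∂μ := by
  set c := ∫ x, g x ∂μ with hc
  by_cases htop : ∫⁻ x, ENNReal.ofReal (Real.exp (g x)) ∂μ = ∞
  · simp [htop]
  have hexp : Integrable (fun x => Real.exp (g x)) μ :=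
    ⟨(Real.continuous_exp.comp_aestronglyMeasurable hg.1), by
      rw [hasFiniteIntegral_iff_ofReal (Filter.Eventually.of_forall fun x => (Real.exp_pos _).le)]
      exact lt_top_iff_ne_top.2 htop⟩
  rw [← ofReal_integral_eq_lintegral_ofReal hexp
    (Filter.Eventually.of_forall fun x => (Real.exp_pos _).le)]
  refine ENNReal.ofReal_le_ofReal ?_
  exact convexOn_exp.map_integral_le Real.continuous_exp.continuousOn isClosed_univ
    (by simp) hg hexp

/-- The shifted law is the base measure because Jensen's inequality is applied under it. The mean of
the log-density is then `-u² / (2v)`, minus the relative entropy of the shift. -/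
lemma gaussianReal_eq_withDensity_shift (u : ℝ) {v : ℝ≥0} (hv : v ≠ 0) :
    gaussianReal 0 v = (gaussianReal u v).withDensity
      fun x => ENNReal.ofReal (Real.exp ((u ^ 2 / 2 - u * x) / v)) := by
  have hv' : (v : ℝ) ≠ 0 := by exact_mod_cast hv
  rw [gaussianReal_of_var_ne_zero _ hv, gaussianReal_of_var_ne_zero _ hv,
    ← withDensity_mul _ (measurable_gaussianPDF _ _) (by fun_prop)]
  congr 1
  funext x
  simp only [gaussianPDF, gaussianPDFReal, Pi.mul_apply]
  rw [← ENNReal.ofReal_mul (by positivity), mul_assoc (Real.sqrt _)⁻¹, ← Real.exp_add]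
  congr 3
  field_simp
  ring

lemma pi_gaussianReal_eq_withDensity_shift {ι : Type*} [Fintype ι] (u : ι → ℝ) {v : ℝ≥0}
    (hv : v ≠ 0) :
    (Measure.pi fun _ : ι => gaussianReal 0 v) =
      (Measure.pi fun i => gaussianReal (u i) v).withDensity
        fun x => ENNReal.ofReal (Real.exp (∑ i, ((u i) ^ 2 / 2 - u i * x i) / v)) := by
  refine Measure.pi_eq fun s hs => ?_
  have hmeas : ∀ i, Measurable fun x : ℝ =>
      (s i).indicator (fun x => ENNReal.ofReal (Real.exp (((u i) ^ 2 / 2 - u i * x) / v))) x :=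
    fun i => Measurable.indicator (by fun_prop) (hs i)
  rw [withDensity_apply _ (MeasurableSet.univ_pi hs), ← lintegral_indicator
    (MeasurableSet.univ_pi hs)]
  have : ∀ x : ι → ℝ, (Set.univ.pi s).indicator (fun x => ENNReal.ofReal
      (Real.exp (∑ i, ((u i) ^ 2 / 2 - u i * x i) / v))) x =
      ∏ i, (s i).indicator
        (fun x => ENNReal.ofReal (Real.exp (((u i) ^ 2 / 2 - u i * x) / v))) (x i) := by
    intro x
    by_cases hx : x ∈ Set.univ.pi s
    · rw [Set.indicator_of_mem hx, Real.exp_sum, ENNReal.ofReal_prod_of_nonneg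
        (fun i _ => (Real.exp_pos _).le)]
      exact Finset.prod_congr rfl fun i _ => by
        rw [Set.indicator_of_mem (hx i (Set.mem_univ i))]
    · rw [Set.indicator_of_notMem hx]
      simp only [Set.mem_univ_pi, not_forall] at hx
      obtain ⟨i, hi⟩ := hx
      exact (Finset.prod_eq_zero (Finset.mem_univ i) (Set.indicator_of_notMem hi _)).symm
  simp_rw [this]
  rw [lintegral_pi_prod (fun i => gaussianReal (u i) v) _ hmeas]
  refine Finset.prod_congr rfl fun i _ => ?_
  rw [lintegral_indicator (hs i), ← withDensity_apply _ (hs i),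
    ← gaussianReal_eq_withDensity_shift (u i) hv]

lemma integrable_sq_gaussianReal (u : ℝ) (v : ℝ≥0) :
    Integrable (fun x : ℝ => x ^ 2) (gaussianReal u v) :=
  (memLp_id_gaussianReal (μ := u) (v := v) 2).integrable_sq

lemma integral_sq_gaussianReal (u : ℝ) (v : ℝ≥0) :
    ∫ x, x ^ 2 ∂gaussianReal u v = u ^ 2 + v := by
  have h := variance_eq_sub (memLp_id_gaussianReal (μ := u) (v := v) 2)
  rw [variance_id_gaussianReal] at h
  simp only [Pi.pow_apply, id, integral_id_gaussianReal] at h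
  linarith

lemma integrable_id_gaussianReal (u : ℝ) (v : ℝ≥0) :
    Integrable (fun x : ℝ => x) (gaussianReal u v) :=
  (memLp_id_gaussianReal (μ := u) (v := v) 1).integrable (by simp)

/-- The variational (PAC-Bayes) lower bound for a Gaussian average of the exponential of a
bilinear form with a quartic correction. -/
lemma ofReal_exp_le_lintegral_gaussian {ι κ : Type*} [Fintype ι] [Fintype κ] (A c : ι → κ → ℝ)
    {v : ℝ≥0} (hv : v ≠ 0) (u : ι → ℝ) (t : κ → ℝ) :
    ENNReal.ofReal (Real.exp (∑ i, ∑ j, (A i j * (u i * t j) -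
        c i j * ((u i ^ 2 + v) * (t j ^ 2 + v))) -
        (∑ i, u i ^ 2 + ∑ j, t j ^ 2) / (2 * v))) ≤
      ∫⁻ z, ENNReal.ofReal (Real.exp (∑ i, ∑ j, (A i j * (z.1 i * z.2 j) -
        c i j * ((z.1 i) ^ 2 * (z.2 j) ^ 2))))
        ∂((Measure.pi fun _ : ι => gaussianReal 0 v).prod
          (Measure.pi fun _ : κ => gaussianReal 0 v)) := by
  have hv' : (v : ℝ) ≠ 0 := by exact_mod_cast hv
  rw [pi_gaussianReal_eq_withDensity_shift u hv, pi_gaussianReal_eq_withDensity_shift t hv,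
    prod_withDensity (by fun_prop) (by fun_prop),
    lintegral_withDensity_eq_lintegral_mul _ (by fun_prop) (by fun_prop)]
  set ρ := Measure.pi fun i => gaussianReal (u i) v
  set ρ' := Measure.pi fun j => gaussianReal (t j) v
  have i1 : ∀ i, Integrable (fun x : ι → ℝ => x i) ρ := fun i =>
    integrable_comp_eval (μ := fun i => gaussianReal (u i) v) (integrable_id_gaussianReal (u i) v)
  have i2 : ∀ i, Integrable (fun x : ι → ℝ => x i ^ 2) ρ := fun i =>
    integrable_comp_eval (μ := fun i => gaussianReal (u i) v) (integrable_sq_gaussianReal (u i) v)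
  have j1 : ∀ i, Integrable (fun x : κ → ℝ => x i) ρ' := fun i =>
    integrable_comp_eval (μ := fun i => gaussianReal (t i) v) (integrable_id_gaussianReal (t i) v)
  have j2 : ∀ i, Integrable (fun x : κ → ℝ => x i ^ 2) ρ' := fun i =>
    integrable_comp_eval (μ := fun i => gaussianReal (t i) v) (integrable_sq_gaussianReal (t i) v)
  have e1 : ∀ i, ∫ x, x i ∂ρ = u i := fun i =>
    (integral_comp_eval (μ := fun i => gaussianReal (u i) v)
      (integrable_id_gaussianReal (u i) v).1).trans integral_id_gaussianReal
  have e2 : ∀ i, ∫ x, x i ^ 2 ∂ρ = u i ^ 2 + v := fun i =>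
    (integral_comp_eval (μ := fun i => gaussianReal (u i) v)
      (integrable_sq_gaussianReal (u i) v).1).trans (integral_sq_gaussianReal _ _)
  have f1 : ∀ i, ∫ x, x i ∂ρ' = t i := fun i =>
    (integral_comp_eval (μ := fun i => gaussianReal (t i) v)
      (integrable_id_gaussianReal (t i) v).1).trans integral_id_gaussianReal
  have f2 : ∀ i, ∫ x, x i ^ 2 ∂ρ' = t i ^ 2 + v := fun i =>
    (integral_comp_eval (μ := fun i => gaussianReal (t i) v)
      (integrable_sq_gaussianReal (t i) v).1).trans (integral_sq_gaussianReal _ _)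
  have I1 : ∀ i j, Integrable (fun z : (ι → ℝ) × (κ → ℝ) => A i j * (z.1 i * z.2 j) -
      c i j * ((z.1 i) ^ 2 * (z.2 j) ^ 2)) (ρ.prod ρ') := fun i j =>
    (((i1 i).mul_prod (j1 j)).const_mul _).sub (((i2 i).mul_prod (j2 j)).const_mul _)
  have I2 : ∀ i, Integrable (fun z : (ι → ℝ) × (κ → ℝ) => (u i ^ 2 / 2 - u i * z.1 i) / v)
      (ρ.prod ρ') := fun i =>
    ((integrable_const _).sub (((i1 i).comp_fst ρ').const_mul _)).div_const _
  have I3 : ∀ j, Integrable (fun z : (ι → ℝ) × (κ → ℝ) => (t j ^ 2 / 2 - t j * z.2 j) / v)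
      (ρ.prod ρ') := fun j =>
    ((integrable_const _).sub (((j1 j).comp_snd ρ).const_mul _)).div_const _
  have hI1 := integrable_finsetSum Finset.univ fun i _ =>
    integrable_finsetSum Finset.univ fun j _ => I1 i j
  have hI2 := integrable_finsetSum Finset.univ fun i _ => I2 i
  have hI3 := integrable_finsetSum Finset.univ fun j _ => I3 j
  -- Jensen under the shifted product law, with the log-densities of the centred laws added to the
  -- exponent; their means give the quadratic penalty in `u` and `t`.
  have key := ofReal_exp_integral_le ((hI1.add hI2).add hI3)
  refine (le_of_eq ?_).trans (key.trans (le_of_eq ?_))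
  · congr 2
    rw [integral_add' (hI1.add hI2) hI3, integral_add' hI1 hI2,
      integral_finsetSum _ (fun i _ => integrable_finsetSum Finset.univ fun j _ => I1 i j),
      integral_finsetSum _ (fun i _ => I2 i), integral_finsetSum _ (fun i _ => I3 i)]
    have a1 : ∀ i, ∫ z, ∑ j, (A i j * (z.1 i * z.2 j) -
        c i j * ((z.1 i) ^ 2 * (z.2 j) ^ 2)) ∂ρ.prod ρ' =
        ∑ j, (A i j * (u i * t j) - c i j * ((u i ^ 2 + v) * (t j ^ 2 + v))) := by
      intro i
      rw [integral_finsetSum _ (fun j _ => I1 i j)]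
      refine Finset.sum_congr rfl fun j _ => ?_
      rw [integral_sub (((i1 i).mul_prod (j1 j)).const_mul _)
        (((i2 i).mul_prod (j2 j)).const_mul _), integral_const_mul, integral_const_mul,
        integral_prod_mul (fun x : ι → ℝ => x i) (fun y : κ → ℝ => y j),
        integral_prod_mul (fun x : ι → ℝ => x i ^ 2) (fun y : κ → ℝ => y j ^ 2),
        e1, e2, f1, f2]
    have a2 : ∀ i, ∫ z : (ι → ℝ) × (κ → ℝ), (u i ^ 2 / 2 - u i * z.1 i) / v ∂ρ.prod ρ' =
        - (u i ^ 2 / (2 * v)) := by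
      intro i
      rw [integral_div, integral_sub (integrable_const _) (((i1 i).comp_fst ρ').const_mul _),
        integral_const_mul, integral_fun_fst (μ := ρ) (ν := ρ') (fun x => x i), e1]
      simp
      field_simp
      ring
    have a3 : ∀ i, ∫ z : (ι → ℝ) × (κ → ℝ), (t i ^ 2 / 2 - t i * z.2 i) / v ∂ρ.prod ρ' =
        - (t i ^ 2 / (2 * v)) := by
      intro i
      rw [integral_div, integral_sub (integrable_const _) (((j1 i).comp_snd ρ).const_mul _),
        integral_const_mul, integral_fun_snd (μ := ρ) (ν := ρ') (fun x => x i), f1]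
      simp
      field_simp
      ring
    simp_rw [a1, a2, a3]
    rw [Finset.sum_neg_distrib, Finset.sum_neg_distrib, ← Finset.sum_div, ← Finset.sum_div]
    ring
  · refine lintegral_congr fun z => ?_
    simp only [Pi.mul_apply, Pi.add_apply]
    rw [← ENNReal.ofReal_mul (Real.exp_pos _).le, ← ENNReal.ofReal_mul (by positivity),
      ← Real.exp_add, ← Real.exp_add]
    congr 2
    ring

/-! ### Integration against the joint law of weights and coins -/

instance (Ψ : ℝ≥0) : IsProbabilityMeasure (weightLaw L n Ψ) := by
  unfold weightLaw; infer_instance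

instance (d Ψ : ℝ≥0) : IsProbabilityMeasure (jointLaw L n d Ψ) := by
  unfold jointLaw; infer_instance

lemma lintegral_bernoulli_bool (p : I) (f : Bool → ℝ≥0∞) :
    ∫⁻ b, f b ∂bernoulliMeasure true false p =
      ENNReal.ofReal p * f true + ENNReal.ofReal (1 - p) * f false := by
  have h1 : ((unitInterval.toNNReal p : ℝ≥0) : ℝ≥0∞) = ENNReal.ofReal p := by
    rw [← unitInterval.coe_toNNReal p, ENNReal.ofReal_coe_nnreal]
  have h2 : ((unitInterval.toNNReal (σ p) : ℝ≥0) : ℝ≥0∞) = ENNReal.ofReal (1 - p) := by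
    rw [← unitInterval.coe_symm_eq p, ← unitInterval.coe_toNNReal (σ p),
      ENNReal.ofReal_coe_nnreal]
  rw [bernoulliMeasure_def, lintegral_add_measure, lintegral_smul_measure,
    lintegral_smul_measure, lintegral_dirac, lintegral_dirac, ← h1, ← h2]
  rfl

/-- Under the joint law of weights and coins the entries are independent. -/
lemma lintegral_jointLaw_prod (d Ψ : ℝ≥0) (h : Entry L n → ℝ → Bool → ℝ≥0∞)
    (hm : ∀ e b, Measurable fun a => h e a b) :
    ∫⁻ p, ∏ e, h e (p.1 e) (p.2 e) ∂jointLaw L n d Ψ =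
      ∏ e, ∫⁻ a, (ENNReal.ofReal (pruneProb d Ψ a) * h e a true +
        ENNReal.ofReal (1 - pruneProb d Ψ a) * h e a false) ∂gaussianReal 0 Ψ := by
  have hm' : ∀ e, Measurable fun p : ℝ × Bool => h e p.1 p.2 := fun e =>
    measurable_from_prod_countable_left fun b => hm e b
  have hmeas : Measurable fun p : Weights L n × Coins L n => ∏ e, h e (p.1 e) (p.2 e) :=
    Finset.measurable_prod _ fun e _ => (hm' e).comp
      (f := fun p : Weights L n × Coins L n => (p.1 e, p.2 e)) (by fun_prop)
  have hpr : Measurable fun a => ((pruneProb d Ψ a : I) : ℝ) :=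
    measurable_subtype_coe.comp (measurable_pruneProb d Ψ)
  rw [jointLaw, Measure.lintegral_compProd hmeas]
  have hin : ∀ w : Weights L n, ∫⁻ X, ∏ e, h e (w e) (X e) ∂coinKernel L n d Ψ w =
      ∏ e, (ENNReal.ofReal (pruneProb d Ψ (w e)) * h e (w e) true +
        ENNReal.ofReal (1 - pruneProb d Ψ (w e)) * h e (w e) false) := by
    intro w
    change ∫⁻ X, ∏ e, h e (w e) (X e) ∂coinLaw d Ψ w = _
    rw [coinLaw, lintegral_pi_prod _ (fun e b => h e (w e) b)
      (fun e => measurable_of_countable _)]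
    exact Finset.prod_congr rfl fun e _ => lintegral_bernoulli_bool _ _
  simp_rw [hin]
  rw [weightLaw]
  exact lintegral_pi_prod (fun _ : Entry L n => gaussianReal 0 Ψ)
    (fun e a => ENNReal.ofReal (pruneProb d Ψ a) * h e a true +
        ENNReal.ofReal (1 - pruneProb d Ψ a) * h e a false)
    (fun e => (hpr.ennreal_ofReal.mul (hm e true)).add
      ((measurable_const.sub hpr).ennreal_ofReal.mul (hm e false)))

/-! ### The law of a removed weight and its exponential moments -/

/-- The probability with which an off-diagonal weight is pruned. -/
noncomputable def rate (d : ℝ≥0) : ℝ := Real.sqrt (d / (d + 2))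

/-- The variance of a weight conditionally on its coin being `true`. -/
noncomputable def prunedVar (d Ψ : ℝ≥0) : ℝ≥0 := d * Ψ / (d + 2)

lemma rate_pos {d : ℝ≥0} (hd : 0 < d) : 0 < rate d := by
  unfold rate
  have : (0 : ℝ) < d := hd
  positivity

lemma prunedVar_pos {d Ψ : ℝ≥0} (hd : 0 < d) (hΨ : 0 < Ψ) : 0 < prunedVar d Ψ := by
  unfold prunedVar; positivity

/-- The precisions add: `1/Ψ + 2/(dΨ) = (d+2)/(dΨ)`. The ratio of the two normalising constants is
the pruning rate. -/
lemma pruneProb_mul_gaussianPDFReal {d Ψ : ℝ≥0} (hd : 0 < d) (hΨ : 0 < Ψ) (a : ℝ) :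
    gaussianPDFReal 0 Ψ a * pruneProb d Ψ a =
      rate d * gaussianPDFReal 0 (prunedVar d Ψ) a := by
  have hd' : (0 : ℝ) < d := hd
  have hΨ' : (0 : ℝ) < Ψ := hΨ
  simp only [gaussianPDFReal, pruneProb, rate, prunedVar]
  push_cast
  rw [mul_assoc, ← Real.exp_add, ← mul_assoc]
  have h1 : (Real.sqrt (2 * Real.pi * Ψ))⁻¹ =
      Real.sqrt (d / (d + 2)) * (Real.sqrt (2 * Real.pi * (d * Ψ / (d + 2))))⁻¹ := by
    rw [← Real.sqrt_inv, ← Real.sqrt_inv, ← Real.sqrt_mul (by positivity)]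
    congr 1
    field_simp
  rw [← h1]
  congr 2
  field_simp
  ring

lemma lintegral_pruneProb_mul {d Ψ : ℝ≥0} (hd : 0 < d) (hΨ : 0 < Ψ) {f : ℝ → ℝ≥0∞}
    (hf : Measurable f) :
    ∫⁻ a, ENNReal.ofReal (pruneProb d Ψ a) * f a ∂gaussianReal 0 Ψ =
      ENNReal.ofReal (rate d) * ∫⁻ a, f a ∂gaussianReal 0 (prunedVar d Ψ) := by
  have hpr : Measurable fun a => ((pruneProb d Ψ a : I) : ℝ) :=
    measurable_subtype_coe.comp (measurable_pruneProb d Ψ)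
  rw [gaussianReal_of_var_ne_zero _ hΨ.ne',
    gaussianReal_of_var_ne_zero _ (prunedVar_pos hd hΨ).ne',
    lintegral_withDensity_eq_lintegral_mul _ (measurable_gaussianPDF _ _)
      (hpr.ennreal_ofReal.fun_mul hf),
    lintegral_withDensity_eq_lintegral_mul _ (measurable_gaussianPDF _ _) hf,
    ← lintegral_const_mul _ ((measurable_gaussianPDF _ _).mul hf)]
  refine lintegral_congr fun a => ?_
  simp only [Pi.mul_apply, gaussianPDF]
  rw [← mul_assoc, ← mul_assoc, ← ENNReal.ofReal_mul (gaussianPDFReal_nonneg _ _ _),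
    pruneProb_mul_gaussianPDFReal hd hΨ, ENNReal.ofReal_mul (rate_pos hd).le]

lemma lintegral_exp_gaussian (v : ℝ≥0) (τ : ℝ) :
    ∫⁻ a, ENNReal.ofReal (Real.exp (τ * a - v * τ ^ 2 / 2)) ∂gaussianReal 0 v = 1 := by
  have h := congrFun (mgf_id_gaussianReal (μ := 0) (v := v)) τ
  simp only [mgf, id, zero_mul, zero_add] at h
  have hi : Integrable (fun a => Real.exp (τ * a - v * τ ^ 2 / 2)) (gaussianReal 0 v) := by
    simp_rw [Real.exp_sub]
    exact (integrable_exp_mul_gaussianReal τ).div_const _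
  rw [← ofReal_integral_eq_lintegral_ofReal hi
    (Filter.Eventually.of_forall fun x => (Real.exp_pos _).le)]
  simp_rw [Real.exp_sub]
  rw [integral_div, h, div_self (Real.exp_pos _).ne', ENNReal.ofReal_one]

lemma lintegral_pruneProb {d Ψ : ℝ≥0} (hd : 0 < d) (hΨ : 0 < Ψ) :
    ∫⁻ a, ENNReal.ofReal (pruneProb d Ψ a) ∂gaussianReal 0 Ψ = ENNReal.ofReal (rate d) := by
  simpa using lintegral_pruneProb_mul hd hΨ (f := fun _ => 1) measurable_const

lemma lintegral_pruneProb_add_compl (d Ψ : ℝ≥0) {c : ℝ≥0∞} :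
    ∫⁻ a, (ENNReal.ofReal (pruneProb d Ψ a) * c +
      ENNReal.ofReal (1 - pruneProb d Ψ a) * c) ∂gaussianReal 0 Ψ = c := by
  simp_rw [← add_mul, ← ENNReal.ofReal_add (pruneProb d Ψ _).2.1
    (sub_nonneg.2 (pruneProb d Ψ _).2.2)]
  simp

/-- The indicator of the entries that are pruned. -/
noncomputable def mask (X : Coins L n) (e : Entry L n) : ℝ :=
  if (e.2.1 : ℕ) ≠ (e.2.2 : ℕ) ∧ X e = true then 1 else 0

/-- The difference between the weights and the pruned weights. -/
noncomputable def removed (w : Weights L n) (X : Coins L n) : Weights L n :=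
  fun e => mask X e * w e

lemma prune_add_removed (w : Weights L n) (X : Coins L n) : prune w X + removed w X = w := by
  funext e
  simp only [Pi.add_apply, prune, removed, mask]
  split_ifs <;> simp

/-- The entries are independent and each factor has mean 1. A kept entry gives 1, and given a
removal the entry is Gaussian, so the quadratic term cancels its moment generating function. The
correction must carry the random mask, not its mean, for this identity to be exact. -/
lemma lintegral_exp_removed {d Ψ : ℝ≥0} (hd : 0 < d) (hΨ : 0 < Ψ) (τ : Entry L n → ℝ) :
    ∫⁻ p, ENNReal.ofReal (Real.exp (∑ e, (removed p.1 p.2 e * τ e -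
      prunedVar d Ψ / 2 * mask p.2 e * τ e ^ 2))) ∂jointLaw L n d Ψ = 1 := by
  let h : Entry L n → ℝ → Bool → ℝ≥0∞ := fun e a b =>
    if (e.2.1 : ℕ) ≠ (e.2.2 : ℕ) ∧ b = true then
      ENNReal.ofReal (Real.exp (τ e * a - prunedVar d Ψ * τ e ^ 2 / 2)) else 1
  have hm : ∀ e b, Measurable fun a => h e a b := by
    intro e b
    by_cases hb : (e.2.1 : ℕ) ≠ (e.2.2 : ℕ) ∧ b = true
    · simp only [h, if_pos hb]; fun_prop
    · simp only [h, if_neg hb]; exact measurable_const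
  have heq : ∀ p : Weights L n × Coins L n, ENNReal.ofReal (Real.exp (∑ e, (removed p.1 p.2 e * τ e -
      prunedVar d Ψ / 2 * mask p.2 e * τ e ^ 2))) = ∏ e, h e (p.1 e) (p.2 e) := by
    intro p
    rw [Real.exp_sum, ENNReal.ofReal_prod_of_nonneg (fun i _ => (Real.exp_pos _).le)]
    refine Finset.prod_congr rfl fun e _ => ?_
    simp only [h, removed, mask]
    split_ifs
    · congr 2; ring
    · simp
  simp_rw [heq]
  rw [lintegral_jointLaw_prod d Ψ h hm]
  refine Finset.prod_eq_one fun e _ => ?_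
  by_cases he : (e.2.1 : ℕ) ≠ (e.2.2 : ℕ)
  · have hpr : Measurable fun a => ((pruneProb d Ψ a : I) : ℝ) :=
      measurable_subtype_coe.comp (measurable_pruneProb d Ψ)
    have hpr' : Measurable fun a => ENNReal.ofReal (1 - (pruneProb d Ψ a : ℝ)) := by fun_prop
    simp only [h, he, ne_eq, not_false_eq_true, true_and, if_true, Bool.false_eq_true, if_false,
      mul_one]
    rw [lintegral_add_right _ hpr',
      lintegral_pruneProb_mul hd hΨ (by fun_prop), lintegral_exp_gaussian, mul_one,
      ← lintegral_pruneProb hd hΨ, ← lintegral_add_right _ hpr']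
    simpa using lintegral_pruneProb_add_compl d Ψ (c := 1)
  · simp only [h, he, false_and, if_false]
    exact lintegral_pruneProb_add_compl d Ψ

/-! ### First and second moments of the coins -/

/-- The indicator that a coin shows `true`. -/
def coin (X : Coins L n) (e : Entry L n) : ℝ := if X e = true then 1 else 0

lemma coin_nonneg (X : Coins L n) (e : Entry L n) : 0 ≤ coin X e := by
  unfold coin; split_ifs <;> simp

lemma coin_le_one (X : Coins L n) (e : Entry L n) : coin X e ≤ 1 := by
  unfold coin; split_ifs <;> simp

lemma mask_le_coin (X : Coins L n) (e : Entry L n) : mask X e ≤ coin X e := by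
  unfold coin mask; split_ifs <;> simp_all

lemma integral_prod_coin {d Ψ : ℝ≥0} (hd : 0 < d) (hΨ : 0 < Ψ) (s : Finset (Entry L n)) :
    ∫ p, ∏ e ∈ s, coin p.2 e ∂jointLaw L n d Ψ = rate d ^ s.card := by
  classical
  have hmeas : Measurable fun p : Weights L n × Coins L n => ∏ e ∈ s, coin p.2 e :=
    (measurable_of_countable fun X : Coins L n => ∏ e ∈ s, coin X e).comp measurable_snd
  rw [integral_eq_lintegral_of_nonneg_ae (Filter.Eventually.of_forall fun p =>
    Finset.prod_nonneg fun e _ => coin_nonneg _ _) hmeas.aestronglyMeasurable]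
  let h : Entry L n → ℝ → Bool → ℝ≥0∞ := fun e _ b =>
    if e ∈ s then (if b = true then 1 else 0) else 1
  have heq : ∀ p : Weights L n × Coins L n, ENNReal.ofReal (∏ e ∈ s, coin p.2 e) =
      ∏ e, h e (p.1 e) (p.2 e) := by
    intro p
    rw [ENNReal.ofReal_prod_of_nonneg fun e _ => coin_nonneg _ _]
    simp only [h]
    rw [Finset.prod_ite_mem, Finset.univ_inter]
    refine Finset.prod_congr rfl fun e _ => ?_
    unfold coin
    split_ifs <;> simp
  simp_rw [heq]
  rw [lintegral_jointLaw_prod d Ψ h (fun e b => measurable_const)]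
  have : ∀ e, ∫⁻ a, (ENNReal.ofReal (pruneProb d Ψ a) * h e a true +
        ENNReal.ofReal (1 - pruneProb d Ψ a) * h e a false) ∂gaussianReal 0 Ψ =
      if e ∈ s then ENNReal.ofReal (rate d) else 1 := by
    intro e
    by_cases he : e ∈ s
    · simp [h, he, lintegral_pruneProb hd hΨ]
    · simp only [h, he, if_false]
      exact lintegral_pruneProb_add_compl d Ψ
  simp_rw [this]
  rw [Finset.prod_ite_mem, Finset.univ_inter, Finset.prod_const, ENNReal.toReal_pow,
    ENNReal.toReal_ofReal (rate_pos hd).le]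

lemma integrable_comp_coins (d Ψ : ℝ≥0) (f : Coins L n → ℝ) :
    Integrable (fun p : Weights L n × Coins L n => f p.2) (jointLaw L n d Ψ) := by
  refine Integrable.of_bound
    ((measurable_of_countable f).comp measurable_snd).aestronglyMeasurable (∑ X, ‖f X‖) ?_
  exact Filter.Eventually.of_forall fun p =>
    Finset.single_le_sum (f := fun X => ‖f X‖) (fun _ _ => norm_nonneg _) (Finset.mem_univ p.2)

lemma integral_coin {d Ψ : ℝ≥0} (hd : 0 < d) (hΨ : 0 < Ψ) (e : Entry L n) :
    ∫ p, coin p.2 e ∂jointLaw L n d Ψ = rate d := by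
  simpa using integral_prod_coin hd hΨ {e}

lemma integral_coin_mul_coin {d Ψ : ℝ≥0} (hd : 0 < d) (hΨ : 0 < Ψ) {e f : Entry L n}
    (h : e ≠ f) :
    ∫ p, coin p.2 e * coin p.2 f ∂jointLaw L n d Ψ = rate d ^ 2 := by
  classical
  simpa [Finset.prod_pair h, Finset.card_pair h] using integral_prod_coin hd hΨ {e, f}

/-- The centered coins are uncorrelated, so the variance of the number of successes among `k`
coins is at most `k` times the success probability. -/
lemma integral_sq_sum_coin_sub_le {d Ψ : ℝ≥0} (hd : 0 < d) (hΨ : 0 < Ψ) {ι : Type*} [Fintype ι]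
    (e : ι → Entry L n) (he : Function.Injective e) :
    ∫ p, (∑ i, coin p.2 (e i) - Fintype.card ι * rate d) ^ 2 ∂jointLaw L n d Ψ ≤
      Fintype.card ι * rate d := by
  classical
  have h1 : ∀ p : Weights L n × Coins L n,
      (∑ i, coin p.2 (e i) - Fintype.card ι * rate d) ^ 2 =
      ∑ i, ∑ j, (coin p.2 (e i) - rate d) * (coin p.2 (e j) - rate d) := by
    intro p
    rw [← Finset.sum_mul_sum, ← sq, Finset.sum_sub_distrib]
    simp
  simp_rw [h1]
  rw [integral_finsetSum _ fun i _ => integrable_comp_coins d Ψ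
    (fun X => ∑ j, (coin X (e i) - rate d) * (coin X (e j) - rate d))]
  have h2 : ∀ i j, ∫ p, (coin p.2 (e i) - rate d) * (coin p.2 (e j) - rate d) ∂jointLaw L n d Ψ ≤
      if i = j then rate d else 0 := by
    intro i j
    have hexp : ∫ p, (coin p.2 (e i) - rate d) * (coin p.2 (e j) - rate d) ∂jointLaw L n d Ψ =
        ∫ p, coin p.2 (e i) * coin p.2 (e j) ∂jointLaw L n d Ψ - rate d ^ 2 := by
      have : ∀ p : Weights L n × Coins L n,
          (coin p.2 (e i) - rate d) * (coin p.2 (e j) - rate d) =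
          coin p.2 (e i) * coin p.2 (e j) - (rate d * coin p.2 (e i) + rate d * coin p.2 (e j)
            - rate d ^ 2) := fun p => by ring
      simp_rw [this]
      rw [integral_sub (integrable_comp_coins d Ψ fun X => coin X (e i) * coin X (e j))
          (integrable_comp_coins d Ψ fun X => rate d * coin X (e i) + rate d * coin X (e j)
            - rate d ^ 2),
        integral_sub (integrable_comp_coins d Ψ fun X => rate d * coin X (e i) +
            rate d * coin X (e j)) (integrable_const _),
        integral_add (integrable_comp_coins d Ψ fun X => rate d * coin X (e i))
          (integrable_comp_coins d Ψ fun X => rate d * coin X (e j)),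
        integral_const_mul, integral_const_mul, integral_coin hd hΨ, integral_coin hd hΨ]
      simp
      ring
    rw [hexp]
    split_ifs with hij
    · subst hij
      have : ∀ p : Weights L n × Coins L n, coin p.2 (e i) * coin p.2 (e i) = coin p.2 (e i) := by
        intro p; unfold coin; split_ifs <;> simp
      simp_rw [this]
      rw [integral_coin hd hΨ]
      nlinarith [sq_nonneg (rate d)]
    · rw [integral_coin_mul_coin hd hΨ (he.ne hij), sub_self]
  calc _ ≤ ∑ i : ι, ∑ j : ι, if i = j then rate d else 0 := by
        refine Finset.sum_le_sum fun i _ => ?_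
        rw [integral_finsetSum _ fun j _ => integrable_comp_coins d Ψ
          (fun X => (coin X (e i) - rate d) * (coin X (e j) - rate d))]
        exact Finset.sum_le_sum fun j _ => h2 i j
    _ = Fintype.card ι * rate d := by simp

/-! ### The spectral norm as a supremum of bilinear forms -/

lemma specNorm_nonneg {p q : ℕ} (A : Matrix (Fin p) (Fin q) ℝ) : 0 ≤ specNorm A := norm_nonneg _

lemma norm_toEuclideanLin_le {p q : ℕ} (A : Matrix (Fin p) (Fin q) ℝ) (x : Vec q) :
    ‖Matrix.toEuclideanLin A x‖ ≤ specNorm A * ‖x‖ :=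
  (LinearMap.toContinuousLinearMap (Matrix.toEuclideanLin A)).le_opNorm x

lemma toEuclideanLin_coord {p q : ℕ} (A : Matrix (Fin p) (Fin q) ℝ) (x : Vec q) (i : Fin p) :
    Matrix.toEuclideanLin A x i = ∑ j, A i j * x j := by
  simp [Matrix.toLpLin_apply, Matrix.mulVec, dotProduct]

/-- Test with the normalisations of `A x` and `x`. -/
lemma specNorm_le_of_forall_bilinear {p q : ℕ} (A : Matrix (Fin p) (Fin q) ℝ) {M : ℝ}
    (h : ∀ (u : Fin p → ℝ) (t : Fin q → ℝ), ∑ i, u i ^ 2 ≤ 1 → ∑ j, t j ^ 2 ≤ 1 →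
      ∑ i, ∑ j, A i j * (u i * t j) ≤ M) : specNorm A ≤ M := by
  have hM : 0 ≤ M := by simpa using h 0 0 (by simp) (by simp)
  refine ContinuousLinearMap.opNorm_le_bound _ hM fun x => ?_
  change ‖Matrix.toEuclideanLin A x‖ ≤ M * ‖x‖
  set y := Matrix.toEuclideanLin A x with hy
  rcases (norm_nonneg y).eq_or_lt with hy0 | hy0
  · rw [← hy0]; positivity
  rcases (norm_nonneg x).eq_or_lt with hx0 | hx0
  · have hx : x = 0 := norm_eq_zero.1 hx0.symm
    simp [hy, hx] at hy0
  have hs : ∀ {k : ℕ} (z : Vec k), 0 < ‖z‖ → ∑ i, (‖z‖⁻¹ * z i) ^ 2 ≤ 1 := by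
    intro k z hz
    simp_rw [mul_pow]
    rw [← Finset.mul_sum, ← EuclideanSpace.real_norm_sq_eq, ← mul_pow, inv_mul_cancel₀ hz.ne',
      one_pow]
  have key := h _ _ (hs y hy0) (hs x hx0)
  have : ∑ i, ∑ j, A i j * ((‖y‖⁻¹ * y i) * (‖x‖⁻¹ * x j)) = ‖y‖ * ‖x‖⁻¹ := by
    have h1 : ∀ i, ∑ j, A i j * ((‖y‖⁻¹ * y i) * (‖x‖⁻¹ * x j)) =
        ‖y‖⁻¹ * ‖x‖⁻¹ * (y i) ^ 2 := by
      intro i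
      rw [show ‖y‖⁻¹ * ‖x‖⁻¹ * (y i) ^ 2 = ‖y‖⁻¹ * ‖x‖⁻¹ * y i * ∑ j, A i j * x j by
        rw [← toEuclideanLin_coord, ← hy]; ring, Finset.mul_sum]
      exact Finset.sum_congr rfl fun j _ => by ring
    simp_rw [h1]
    rw [← Finset.mul_sum, ← EuclideanSpace.real_norm_sq_eq]
    field_simp
  rw [this, mul_inv_le_iff₀ hx0] at key
  exact key

lemma continuous_specNorm {p q : ℕ} :
    Continuous (specNorm : Matrix (Fin p) (Fin q) ℝ → ℝ) := by
  have : Continuous fun A : Matrix (Fin p) (Fin q) ℝ =>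
      LinearMap.toContinuousLinearMap (Matrix.toEuclideanLin A) :=
    LinearMap.continuous_of_finiteDimensional
      ((LinearMap.toContinuousLinearMap (𝕜 := ℝ) (E := Vec q) (F' := Vec p)).toLinearMap ∘ₗ
        (Matrix.toEuclideanLin (𝕜 := ℝ) (m := Fin p) (n := Fin q)).toLinearMap)
  exact this.norm

lemma continuous_layer (l : Fin L) : Continuous fun w : Weights L n => layer w l :=
  continuous_matrix fun _ _ => continuous_apply _

lemma continuous_removed (X : Coins L n) : Continuous fun w : Weights L n => removed w X :=
  continuous_pi fun e => continuous_const.mul (continuous_apply e)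

/-- Measurability on `Weights × Coins` of a function that is continuous in the weights. -/
lemma measurable_of_continuous_weights {f : Weights L n × Coins L n → ℝ}
    (hf : ∀ X, Continuous fun w => f (w, X)) : Measurable f :=
  measurable_from_prod_countable_left fun X => (hf X).measurable

/-! ### The expected spectral norm of the removed part of a layer -/

/-- The Gaussian average dominates the exponential at every pair `u`, `t` in the unit balls, up to a
smoothing cost independent of the pair. Centring at `u`, `t` costs at most `1 / v` in entropy. The
noise turns `u i ^ 2 * t j ^ 2` into `(u i ^ 2 + v) * (t j ^ 2 + v)`, whose expansion against `b`
yields the entrywise bound, the row sums, the column sums and the total. -/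
lemma exp_specNorm_le_lintegral {P Q : ℕ} (A : Matrix (Fin P) (Fin Q) ℝ)
    (m b : Fin P → Fin Q → ℝ) (hb1 : ∀ i j, b i j ≤ 1)
    (hmb : ∀ i j, m i j ≤ b i j) {lam s D₁ D₂ : ℝ} (hlam : 0 < lam) (hs : 0 ≤ s) {v : ℝ≥0}
    (hv : v ≠ 0) (hD₁ : 0 ≤ D₁) (hD₂ : 0 ≤ D₂)
    (hr : ∀ i, ∑ j, b i j ≤ D₁) (hc : ∀ j, ∑ i, b i j ≤ D₂) :
    ENNReal.ofReal (Real.exp (lam * specNorm A -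
      (lam ^ 2 * s / 2 * (1 + v * D₁ + v * D₂ + v ^ 2 * ∑ i, ∑ j, b i j) + 1 / v))) ≤
      ∫⁻ z, ENNReal.ofReal (Real.exp (∑ i, ∑ j, (lam * A i j * (z.1 i * z.2 j) -
        lam ^ 2 * s / 2 * m i j * ((z.1 i) ^ 2 * (z.2 j) ^ 2))))
        ∂((Measure.pi fun _ : Fin P => gaussianReal 0 v).prod
          (Measure.pi fun _ : Fin Q => gaussianReal 0 v)) := by
  set G := ∫⁻ z, ENNReal.ofReal (Real.exp (∑ i, ∑ j, (lam * A i j * (z.1 i * z.2 j) -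
        lam ^ 2 * s / 2 * m i j * ((z.1 i) ^ 2 * (z.2 j) ^ 2))))
        ∂((Measure.pi fun _ : Fin P => gaussianReal 0 v).prod
          (Measure.pi fun _ : Fin Q => gaussianReal 0 v)) with hG
  set K := lam ^ 2 * s / 2 * (1 + v * D₁ + v * D₂ + v ^ 2 * ∑ i, ∑ j, b i j) + 1 / v with hK
  have hv' : (0 : ℝ) < v := lt_of_le_of_ne v.2 (by exact_mod_cast hv.symm)
  have key : ∀ (u : Fin P → ℝ) (t : Fin Q → ℝ), ∑ i, u i ^ 2 ≤ 1 → ∑ j, t j ^ 2 ≤ 1 →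
      ENNReal.ofReal (Real.exp (lam * ∑ i, ∑ j, A i j * (u i * t j) - K)) ≤ G := by
    intro u t hu ht
    refine le_trans (ENNReal.ofReal_le_ofReal (Real.exp_le_exp.2 ?_))
      (ofReal_exp_le_lintegral_gaussian (fun i j => lam * A i j)
        (fun i j => lam ^ 2 * s / 2 * m i j) hv u t)
    have hsplit : ∑ i, ∑ j, (lam * A i j * (u i * t j) -
        lam ^ 2 * s / 2 * m i j * ((u i ^ 2 + v) * (t j ^ 2 + v))) =
        lam * ∑ i, ∑ j, A i j * (u i * t j) -
          lam ^ 2 * s / 2 * ∑ i, ∑ j, m i j * ((u i ^ 2 + v) * (t j ^ 2 + v)) := by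
      simp_rw [Finset.sum_sub_distrib, Finset.mul_sum, mul_assoc]
    rw [hsplit, hK]
    have h1 : ∑ i, ∑ j, m i j * ((u i ^ 2 + v) * (t j ^ 2 + v)) ≤
        1 + v * D₁ + v * D₂ + v ^ 2 * ∑ i, ∑ j, b i j := by
      calc _ ≤ ∑ i, ∑ j, b i j * ((u i ^ 2 + v) * (t j ^ 2 + v)) :=
            Finset.sum_le_sum fun i _ => Finset.sum_le_sum fun j _ =>
              mul_le_mul_of_nonneg_right (hmb i j) (by positivity)
        _ = ∑ i, ∑ j, b i j * (u i ^ 2 * t j ^ 2) + v * ∑ i, u i ^ 2 * ∑ j, b i j +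
            v * ∑ j, t j ^ 2 * ∑ i, b i j + v ^ 2 * ∑ i, ∑ j, b i j := by
          have hcomm : ∑ j, t j ^ 2 * ∑ i, b i j = ∑ i, ∑ j, t j ^ 2 * b i j := by
            rw [Finset.sum_comm]; simp_rw [Finset.mul_sum]
          rw [hcomm]
          simp_rw [Finset.mul_sum, ← Finset.sum_add_distrib]
          exact Finset.sum_congr rfl fun i _ => Finset.sum_congr rfl fun j _ => by ring
        _ ≤ 1 + v * D₁ + v * D₂ + v ^ 2 * ∑ i, ∑ j, b i j := by
          have a1 : ∑ i, ∑ j, b i j * (u i ^ 2 * t j ^ 2) ≤ 1 := by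
            calc _ ≤ ∑ i, ∑ j, u i ^ 2 * t j ^ 2 :=
                  Finset.sum_le_sum fun i _ => Finset.sum_le_sum fun j _ =>
                    mul_le_of_le_one_left (by positivity) (hb1 i j)
              _ = (∑ i, u i ^ 2) * ∑ j, t j ^ 2 := (Finset.sum_mul_sum _ _ _ _).symm
              _ ≤ 1 := mul_le_one₀ hu (Finset.sum_nonneg fun j _ => sq_nonneg _) ht
          have a2 : ∑ i, u i ^ 2 * ∑ j, b i j ≤ D₁ := by
            calc _ ≤ ∑ i, u i ^ 2 * D₁ := Finset.sum_le_sum fun i _ =>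
                  mul_le_mul_of_nonneg_left (hr i) (sq_nonneg _)
              _ = (∑ i, u i ^ 2) * D₁ := (Finset.sum_mul _ _ _).symm
              _ ≤ D₁ := mul_le_of_le_one_left hD₁ hu
          have a3 : ∑ j, t j ^ 2 * ∑ i, b i j ≤ D₂ := by
            calc _ ≤ ∑ j, t j ^ 2 * D₂ := Finset.sum_le_sum fun i _ =>
                  mul_le_mul_of_nonneg_left (hc i) (sq_nonneg _)
              _ = (∑ i, t i ^ 2) * D₂ := (Finset.sum_mul _ _ _).symm
              _ ≤ D₂ := mul_le_of_le_one_left hD₂ ht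
          have a2' := mul_le_mul_of_nonneg_left a2 hv'.le
          have a3' := mul_le_mul_of_nonneg_left a3 hv'.le
          linarith
    have h2 : (∑ i, u i ^ 2 + ∑ j, t j ^ 2) / (2 * v) ≤ 1 / v := by
      rw [div_le_div_iff₀ (by positivity) hv']
      nlinarith
    have h3 := mul_le_mul_of_nonneg_left h1 (show 0 ≤ lam ^ 2 * s / 2 by positivity)
    linarith
  by_cases htop : G = ∞
  · simp [htop]
  have hpos : 0 < G.toReal := by
    have := key 0 0 (by simp) (by simp)
    refine ENNReal.toReal_pos (fun h0 => ?_) htop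
    rw [h0] at this
    simp at this
    exact absurd this (not_le.2 (Real.exp_pos _))
  -- After taking logarithms the bound is linear in the bilinear form and uniform in `u` and `t`, so
  -- it passes to the supremum.
  have hN : specNorm A ≤ (Real.log G.toReal + K) / lam := by
    refine specNorm_le_of_forall_bilinear A fun u t hu ht => ?_
    rw [le_div_iff₀ hlam]
    have h1 := key u t hu ht
    rw [ENNReal.ofReal_le_iff_le_toReal htop, ← Real.le_log_iff_exp_le hpos] at h1
    linarith
  rw [ENNReal.ofReal_le_iff_le_toReal htop, ← Real.le_log_iff_exp_le hpos]
  rw [le_div_iff₀ hlam] at hN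
  linarith

/-- Parameters vanishing outside layer `l` turn the moment identity for all entries into one for
that layer alone. -/
lemma sum_entry_update {M : Type*} [AddCommMonoid M] (l : Fin L)
    (F : Entry L n → ℝ → M) (hF : ∀ e, F e 0 = 0) (τ : Fin (n (l + 1)) → Fin (n l) → ℝ) :
    ∑ e : Entry L n, F e (Function.update
      (0 : ∀ k : Fin L, Fin (n (k + 1)) → Fin (n k) → ℝ) l τ e.1 e.2.1 e.2.2) =
    ∑ i, ∑ j, F ⟨l, (i, j)⟩ (τ i j) := by
  rw [Fintype.sum_sigma, Finset.sum_eq_single l]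
  · simp only [Function.update_self]
    rw [Fintype.sum_prod_type]
  · intro k _ hk
    refine Finset.sum_eq_zero fun x _ => ?_
    simp only [Function.update_of_ne hk]
    exact hF _
  · simp

/-- Exponential moments of the bilinear form of the removed weights of one layer. -/
lemma lintegral_exp_layer_removed {d Ψ : ℝ≥0} (hd : 0 < d) (hΨ : 0 < Ψ) (l : Fin L) (lam : ℝ)
    (x : Fin (n (l + 1)) → ℝ) (y : Fin (n l) → ℝ) :
    ∫⁻ p, ENNReal.ofReal (Real.exp (∑ i, ∑ j, (lam * layer (removed p.1 p.2) l i j * (x i * y j) -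
      lam ^ 2 * prunedVar d Ψ / 2 * mask p.2 ⟨l, (i, j)⟩ * ((x i) ^ 2 * (y j) ^ 2))))
      ∂jointLaw L n d Ψ = 1 := by
  rw [← lintegral_exp_removed hd hΨ fun e => Function.update
      (0 : ∀ k : Fin L, Fin (n (k + 1)) → Fin (n k) → ℝ) l
      (fun i j => lam * (x i * y j)) e.1 e.2.1 e.2.2]
  refine lintegral_congr fun p => ?_
  rw [sum_entry_update l (fun e t => removed p.1 p.2 e * t -
      prunedVar d Ψ / 2 * mask p.2 e * t ^ 2) (by simp)]
  congr 2
  refine Finset.sum_congr rfl fun i _ => Finset.sum_congr rfl fun j _ => ?_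
  simp only [layer, Matrix.of_apply]
  ring

/-- By AM-GM the maximal deviation is bounded by a sum of squared deviations, whose mean needs only
variances of the coins. The scale `r` is free. -/
lemma le_add_sum_sq {ι : Type*} [Fintype ι] (R : ι → ℝ) (c : ℝ) {r : ℝ} (hr : 0 < r) (i : ι) :
    R i ≤ c + (r / 2 + (∑ k, (R k - c) ^ 2) / (2 * r)) := by
  have h1 : (R i - c) ^ 2 ≤ ∑ k, (R k - c) ^ 2 :=
    Finset.single_le_sum (f := fun k => (R k - c) ^ 2) (fun _ _ => sq_nonneg _) (Finset.mem_univ i)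
  have h2 : R i - c ≤ r / 2 + (R i - c) ^ 2 / (2 * r) := by
    have : r / 2 + (R i - c) ^ 2 / (2 * r) - (R i - c) = (r - (R i - c)) ^ 2 / (2 * r) := by
      field_simp; ring
    have h3 : 0 ≤ (r - (R i - c)) ^ 2 / (2 * r) := by positivity
    linarith
  have h3 : (R i - c) ^ 2 / (2 * r) ≤ (∑ k, (R k - c) ^ 2) / (2 * r) := by gcongr
  linarith

/-- The bound for the expected norm of the removed part of a layer, with a free parameter. -/
lemma lintegral_specNorm_removed_le_param {d Ψ : ℝ≥0} (hd : 0 < d) (hΨ : 0 < Ψ) (l : Fin L)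
    {r lam : ℝ} (hr : 0 < r) (hr2 : r ^ 2 = n (l + 1) * n l * rate d) (hlam : 0 < lam) :
    ENNReal.ofReal lam *
      ∫⁻ p, ENNReal.ofReal (specNorm (layer (removed p.1 p.2) l)) ∂jointLaw L n d Ψ ≤
      ENNReal.ofReal (lam ^ 2 * prunedVar d Ψ / 2 *
        (4 + rate d * (n (l + 1) + n l) / r) + r) := by
  have hp := rate_pos hd
  set P := n (l + 1)
  set Q := n l
  set s : ℝ := (prunedVar d Ψ : ℝ) with hs
  have hs0 : 0 ≤ s := (prunedVar d Ψ).2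
  -- With `v = 1 / r` the entropy cost is `r`, and the total-sum term `v ^ 2 * T` has mean 1.
  let v : ℝ≥0 := ⟨r⁻¹, (inv_pos.2 hr).le⟩
  have hvr : (v : ℝ) = r⁻¹ := rfl
  have hv : v ≠ 0 := by
    intro h
    have : (v : ℝ) = 0 := by rw [h]; rfl
    rw [hvr] at this
    exact (inv_pos.2 hr).ne' this
  let b : Coins L n → Fin P → Fin Q → ℝ := fun X i j => coin X ⟨l, (i, j)⟩
  let V₁ : Coins L n → ℝ := fun X => ∑ i, (∑ j, b X i j - Q * rate d) ^ 2
  let V₂ : Coins L n → ℝ := fun X => ∑ j, (∑ i, b X i j - P * rate d) ^ 2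
  -- Bounds on all row sums, respectively column sums, given the coins. They use `coin` instead of
  -- `mask`, so that diagonal positions have the same mean as the others.
  let D₁ : Coins L n → ℝ := fun X => Q * rate d + (r / 2 + V₁ X / (2 * r))
  let D₂ : Coins L n → ℝ := fun X => P * rate d + (r / 2 + V₂ X / (2 * r))
  have hV₁ : ∀ X, 0 ≤ V₁ X := fun X => Finset.sum_nonneg fun _ _ => sq_nonneg _
  have hV₂ : ∀ X, 0 ≤ V₂ X := fun X => Finset.sum_nonneg fun _ _ => sq_nonneg _
  have hD₁ : ∀ X, 0 ≤ D₁ X := fun X => by have := hV₁ X; simp only [D₁]; positivity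
  have hD₂ : ∀ X, 0 ≤ D₂ X := fun X => by have := hV₂ X; simp only [D₂]; positivity
  let T : Coins L n → ℝ := fun X => ∑ i, ∑ j, b X i j
  have hT : ∀ X, 0 ≤ T X := fun X =>
    Finset.sum_nonneg fun _ _ => Finset.sum_nonneg fun _ _ => coin_nonneg _ _
  let K : Coins L n → ℝ := fun X =>
    lam ^ 2 * s / 2 * (1 + v * D₁ X + v * D₂ X + v ^ 2 * T X) + 1 / v
  have hK : ∀ X, 0 ≤ K X := fun X => by
    have := hD₁ X; have := hD₂ X; have := hT X; simp only [K]; positivity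
  let γ := (Measure.pi fun _ : Fin P => gaussianReal 0 v).prod
    (Measure.pi fun _ : Fin Q => gaussianReal 0 v)
  let f : (Weights L n × Coins L n) → ((Fin P → ℝ) × (Fin Q → ℝ)) → ℝ≥0∞ := fun p z =>
    ENNReal.ofReal (Real.exp (∑ i, ∑ j, (lam * layer (removed p.1 p.2) l i j * (z.1 i * z.2 j) -
        lam ^ 2 * s / 2 * mask p.2 ⟨l, (i, j)⟩ * ((z.1 i) ^ 2 * (z.2 j) ^ 2))))
  have hmask : ∀ e, Measurable fun p : Weights L n × Coins L n => mask p.2 e := fun e =>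
    (measurable_of_countable fun X : Coins L n => mask X e).comp measurable_snd
  have hf : Measurable (Function.uncurry f) := by
    refine (Real.measurable_exp.comp (Finset.measurable_sum _ fun i _ =>
      Finset.measurable_sum _ fun j _ => ?_)).ennreal_ofReal
    have h1 : Measurable fun q : (Weights L n × Coins L n) × ((Fin P → ℝ) × (Fin Q → ℝ)) =>
        mask q.1.2 ⟨l, (i, j)⟩ := (hmask _).comp measurable_fst
    simp only [layer, Matrix.of_apply, removed]
    fun_prop
  have hG : ∫⁻ p, ∫⁻ z, f p z ∂γ ∂jointLaw L n d Ψ = 1 := by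
    rw [lintegral_lintegral_swap hf.aemeasurable]
    have : ∀ z, ∫⁻ p, f p z ∂jointLaw L n d Ψ = 1 := fun z =>
      lintegral_exp_layer_removed hd hΨ l lam z.1 z.2
    simp_rw [this]
    simp
  have hpt : ∀ p : Weights L n × Coins L n,
      ENNReal.ofReal lam * ENNReal.ofReal (specNorm (layer (removed p.1 p.2) l)) + 1 ≤
        ∫⁻ z, f p z ∂γ + ENNReal.ofReal (K p.2) := by
    intro p
    have h1 : ENNReal.ofReal (Real.exp (lam * specNorm (layer (removed p.1 p.2) l) - K p.2)) ≤
        ∫⁻ z, f p z ∂γ :=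
      exp_specNorm_le_lintegral (layer (removed p.1 p.2) l)
        (fun i j => mask p.2 ⟨l, (i, j)⟩) (b p.2)
        (fun _ _ => coin_le_one _ _) (fun _ _ => mask_le_coin _ _) hlam hs0 hv (hD₁ p.2) (hD₂ p.2)
        (fun i => le_add_sum_sq (fun i => ∑ j, b p.2 i j) (Q * rate d) hr i)
        (fun j => le_add_sum_sq (fun j => ∑ i, b p.2 i j) (P * rate d) hr j)
    refine le_trans ?_ (add_le_add_left h1 _)
    rw [← ENNReal.ofReal_mul hlam.le, ← ENNReal.ofReal_one,
      ← ENNReal.ofReal_add (mul_nonneg hlam.le (specNorm_nonneg _)) zero_le_one,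
      ← ENNReal.ofReal_add (Real.exp_pos _).le (hK _)]
    refine ENNReal.ofReal_le_ofReal ?_
    -- Using `1 + y ≤ exp y` instead of a logarithm keeps the random term `K` additive, so only its
    -- mean is needed.
    have := Real.add_one_le_exp (lam * specNorm (layer (removed p.1 p.2) l) - K p.2)
    linarith
  have hsum_le := lintegral_mono (μ := jointLaw L n d Ψ) hpt
  have hKm : Measurable fun p : Weights L n × Coins L n => ENNReal.ofReal (K p.2) :=
    ((measurable_of_countable K).comp measurable_snd).ennreal_ofReal
  have hNm : Measurable fun p : Weights L n × Coins L n =>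
      ENNReal.ofReal (specNorm (layer (removed p.1 p.2) l)) :=
    (measurable_of_continuous_weights fun X =>
      continuous_specNorm.comp ((continuous_layer l).comp (continuous_removed X))).ennreal_ofReal
  rw [lintegral_add_right _ measurable_const, lintegral_add_right _ hKm, hG,
    lintegral_const_mul _ hNm, lintegral_one, measure_univ, add_comm 1] at hsum_le
  have hsum_le' := (ENNReal.add_le_add_iff_right ENNReal.one_ne_top).1 hsum_le
  refine hsum_le'.trans ?_
  rw [← ofReal_integral_eq_lintegral_ofReal (integrable_comp_coins d Ψ K)
    (Filter.Eventually.of_forall fun p => hK p.2)]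
  refine ENNReal.ofReal_le_ofReal ?_
  have iV₁ : ∫ p, V₁ p.2 ∂jointLaw L n d Ψ ≤ r ^ 2 := by
    simp only [V₁]
    rw [integral_finsetSum _ fun i _ => integrable_comp_coins d Ψ
      fun X => (∑ j, b X i j - Q * rate d) ^ 2]
    calc _ ≤ ∑ i : Fin P, (Q * rate d : ℝ) := Finset.sum_le_sum fun i _ => by
          simpa using integral_sq_sum_coin_sub_le hd hΨ (fun j : Fin Q => (⟨l, (i, j)⟩ : Entry L n))
            (fun j j' h => by simpa using h)
      _ = r ^ 2 := by rw [hr2]; simp [mul_assoc]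
  have iV₂ : ∫ p, V₂ p.2 ∂jointLaw L n d Ψ ≤ r ^ 2 := by
    simp only [V₂]
    rw [integral_finsetSum _ fun j _ => integrable_comp_coins d Ψ
      fun X => (∑ i, b X i j - P * rate d) ^ 2]
    calc _ ≤ ∑ i : Fin Q, (P * rate d : ℝ) := Finset.sum_le_sum fun j _ => by
          simpa using integral_sq_sum_coin_sub_le hd hΨ (fun i : Fin P => (⟨l, (i, j)⟩ : Entry L n))
            (fun j j' h => by simpa using h)
      _ = r ^ 2 := by rw [hr2]; simp; ring
  have iT : ∫ p, T p.2 ∂jointLaw L n d Ψ = r ^ 2 := by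
    simp only [T]
    rw [integral_finsetSum _ fun i _ => integrable_comp_coins d Ψ fun X => ∑ j, b X i j]
    have : ∀ i, ∫ p, ∑ j, b p.2 i j ∂jointLaw L n d Ψ = Q * rate d := by
      intro i
      rw [integral_finsetSum _ fun j _ => integrable_comp_coins d Ψ fun X => b X i j]
      simp [b, integral_coin hd hΨ]
    simp_rw [this]
    rw [hr2]; simp [mul_assoc]
  -- On average the bracket in `K` is at most `4 + p(P+Q)/r`: 2 from the constants 1, 1/2, 1/2, then
  -- at most 1 from the two variances and exactly 1 from the total.
  have hKeq : ∀ X, K X = (lam ^ 2 * s / 2 * (2 + rate d * (P + Q) / r) + r) +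
      (lam ^ 2 * s / 2) * ((V₁ X + V₂ X) / (2 * r ^ 2) + T X / r ^ 2) := by
    intro X
    simp only [K, D₁, D₂, hvr]
    field_simp
    ring
  simp_rw [hKeq]
  rw [integral_add (integrable_const _) (integrable_comp_coins d Ψ fun X =>
      (lam ^ 2 * s / 2) * ((V₁ X + V₂ X) / (2 * r ^ 2) + T X / r ^ 2)), integral_const_mul,
    integral_add (integrable_comp_coins d Ψ fun X => (V₁ X + V₂ X) / (2 * r ^ 2))
      (integrable_comp_coins d Ψ fun X => T X / r ^ 2), integral_div, integral_div,
    integral_add (integrable_comp_coins d Ψ V₁) (integrable_comp_coins d Ψ V₂), iT]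
  simp only [integral_const, probReal_univ, one_smul]
  have h1 : (∫ p, V₁ p.2 ∂jointLaw L n d Ψ + ∫ p, V₂ p.2 ∂jointLaw L n d Ψ) / (2 * r ^ 2) ≤ 1 := by
    rw [div_le_one (by positivity)]; linarith
  have h2 : r ^ 2 / r ^ 2 = 1 := div_self (by positivity)
  rw [h2]
  have h3 := mul_le_mul_of_nonneg_left h1 (show 0 ≤ lam ^ 2 * s / 2 by positivity)
  linarith

lemma sqrt_prunedVar_mul_rate {d Ψ : ℝ≥0} (hd : 0 < d) :
    (d : ℝ) ^ (3 / 2 : ℝ) * Ψ / ((d : ℝ) + 2) ^ (3 / 2 : ℝ) = prunedVar d Ψ * rate d := by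
  have hd' : (0 : ℝ) < d := hd
  have h : ∀ x : ℝ, 0 < x → x ^ (3 / 2 : ℝ) = x * Real.sqrt x := by
    intro x hx
    rw [show (3 / 2 : ℝ) = 1 + 1 / 2 by norm_num, Real.rpow_add hx, Real.rpow_one,
      Real.sqrt_eq_rpow]
  rw [h _ hd', h _ (by positivity), rate, prunedVar, Real.sqrt_div hd'.le]
  push_cast
  field_simp

lemma prunedVar_sq_mul_rate {d Ψ : ℝ≥0} (hd : 0 < d) (a : ℝ) :
    a * (d : ℝ) ^ (5 / 2 : ℝ) * (Ψ : ℝ) ^ 2 / ((d : ℝ) + 2) ^ (5 / 2 : ℝ) =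
      a * (prunedVar d Ψ ^ 2 * rate d) := by
  have hd' : (0 : ℝ) < d := hd
  have h : ∀ x : ℝ, 0 < x → x ^ (5 / 2 : ℝ) = x ^ 2 * Real.sqrt x := by
    intro x hx
    rw [show (5 / 2 : ℝ) = (2 : ℕ) + 1 / 2 by norm_num, Real.rpow_add hx, Real.rpow_natCast,
      Real.sqrt_eq_rpow]
  rw [h _ hd', h _ (by positivity), rate, prunedVar, Real.sqrt_div hd'.le]
  push_cast
  field_simp

lemma Gam_nonneg {C : ℝ} (hC : 0 ≤ C) (d Ψ : ℝ≥0) (a b : ℕ) : 0 ≤ Gam C d Ψ a b := by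
  unfold Gam; positivity

/-- The expected spectral norm of the removed part of a layer is at most `Γ`. -/
theorem lintegral_specNorm_removed_le {d Ψ : ℝ≥0} (hd : 0 < d) (hΨ : 0 < Ψ) (l : Fin L) :
    ∫⁻ p, ENNReal.ofReal (specNorm (layer (removed p.1 p.2) l)) ∂jointLaw L n d Ψ ≤
      ENNReal.ofReal (Gam 3 d Ψ (n (l + 1)) (n l)) := by
  -- An empty matrix has norm 0; it is set aside because `r` below must be positive.
  by_cases h0 : n (l + 1) = 0 ∨ n l = 0
  · have : ∀ A : Matrix (Fin (n (l + 1))) (Fin (n l)) ℝ, specNorm A = 0 := by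
      intro A
      refine le_antisymm (specNorm_le_of_forall_bilinear A fun u t _ _ => le_of_eq ?_)
        (specNorm_nonneg A)
      rcases h0 with h | h
      · have : IsEmpty (Fin (n (l + 1))) := by rw [h]; infer_instance
        simp
      · have : IsEmpty (Fin (n l)) := by rw [h]; infer_instance
        simp
    simp [this]
  push Not at h0
  have hP : (0 : ℝ) < n (l + 1) := by exact_mod_cast Nat.pos_of_ne_zero h0.1
  have hQ : (0 : ℝ) < n l := by exact_mod_cast Nat.pos_of_ne_zero h0.2
  have hp := rate_pos hd
  have hs : (0 : ℝ) < prunedVar d Ψ := prunedVar_pos hd hΨ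
  unfold Gam
  rw [sqrt_prunedVar_mul_rate hd, prunedVar_sq_mul_rate hd]
  set P : ℝ := (n (l + 1) : ℝ)
  set Q : ℝ := (n l : ℝ)
  set p := rate d
  set s : ℝ := (prunedVar d Ψ : ℝ)
  set r := Real.sqrt (P * Q * p) with hrdef
  have hr : 0 < r := Real.sqrt_pos.2 (by positivity)
  have hr2 : r ^ 2 = P * Q * p := Real.sq_sqrt (by positivity)
  set F := s * (4 + p * (P + Q) / r) with hF
  have hFpos : 0 < F := by positivity
  -- This balances `lam * F / 2` against `r / lam` up to a constant, and leaves `3/2 * sqrt (r *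
  -- F)`.
  set lam := Real.sqrt (r / F) with hlamdef
  have hlam : 0 < lam := Real.sqrt_pos.2 (by positivity)
  have hlam2 : lam ^ 2 = r / F := Real.sq_sqrt (by positivity)
  have key := lintegral_specNorm_removed_le_param hd hΨ l hr hr2 hlam
  have h1 : lam ^ 2 * s / 2 * (4 + p * (P + Q) / r) + r = 3 / 2 * r := by
    have : lam ^ 2 * s / 2 * (4 + p * (P + Q) / r) = lam ^ 2 * F / 2 := by rw [hF]; ring
    rw [this, hlam2]
    field_simp
    ring
  rw [h1] at key
  have hle : ∫⁻ q, ENNReal.ofReal (specNorm (layer (removed q.1 q.2) l)) ∂jointLaw L n d Ψ ≤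
      ENNReal.ofReal (3 / 2 * r / lam) := by
    rw [ENNReal.ofReal_div_of_pos hlam, ENNReal.le_div_iff_mul_le
      (Or.inl (by simpa using hlam)) (Or.inl ENNReal.ofReal_ne_top), mul_comm]
    exact key
  refine hle.trans (ENNReal.ofReal_le_ofReal ?_)
  have h2 : r / lam = Real.sqrt (r * F) := by
    rw [hlamdef, Real.sqrt_div hr.le, Real.sqrt_mul hr.le]
    have := Real.sq_sqrt hr.le
    have h3 := Real.sqrt_pos.2 hr
    have h4 := Real.sqrt_pos.2 hFpos
    field_simp
    linarith
  have h3 : r * F = 4 * (s * r) + s * p * (P + Q) := by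
    rw [hF]; field_simp
  have h4 : Real.sqrt (r * F) ≤ 2 * Real.sqrt (s * r) +
      Real.sqrt (s * p) * (Real.sqrt P + Real.sqrt Q) := by
    refine Real.sqrt_le_iff.2 ⟨by positivity, ?_⟩
    rw [h3]
    have e1 := Real.sq_sqrt (show 0 ≤ s * r by positivity)
    have e2 := Real.sq_sqrt (show 0 ≤ s * p by positivity)
    have e3 := Real.sq_sqrt hP.le
    have e4 := Real.sq_sqrt hQ.le
    have e5 : (2 * Real.sqrt (s * r) + Real.sqrt (s * p) * (Real.sqrt P + Real.sqrt Q)) ^ 2 =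
        4 * (Real.sqrt (s * r)) ^ 2 + Real.sqrt (s * p) ^ 2 * (Real.sqrt P ^ 2 + Real.sqrt Q ^ 2) +
        (4 * Real.sqrt (s * r) * Real.sqrt (s * p) * (Real.sqrt P + Real.sqrt Q) +
          2 * Real.sqrt (s * p) ^ 2 * Real.sqrt P * Real.sqrt Q) := by ring
    rw [e5, e1, e2, e3, e4]
    have : 0 ≤ 4 * Real.sqrt (s * r) * Real.sqrt (s * p) * (Real.sqrt P + Real.sqrt Q) +
          2 * (s * p) * Real.sqrt P * Real.sqrt Q := by positivity
    linarith
  -- Here `(s r)² = s² P Q p`; the factor 3 inside `Gam` is slack.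
  have h5 : Real.sqrt (s * r) ≤ (3 * P * Q * (s ^ 2 * p)) ^ (1 / 4 : ℝ) := by
    have e : Real.sqrt (s * r) = ((s * r) ^ 2) ^ (1 / 4 : ℝ) := by
      rw [Real.sqrt_eq_rpow, ← Real.rpow_natCast, ← Real.rpow_mul (by positivity)]
      norm_num
    rw [e]
    refine Real.rpow_le_rpow (by positivity) ?_ (by norm_num)
    rw [mul_pow, hr2]
    have : 0 ≤ s ^ 2 * (P * Q * p) := by positivity
    linarith
  have h6 : 0 ≤ Real.sqrt (s * p) * (Real.sqrt P + Real.sqrt Q) := by positivity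
  rw [mul_div_assoc, h2]
  linarith

/-! ### Column norms -/

/-- The largest Euclidean norm of a column. -/
noncomputable def colNorm {p q : ℕ} (A : Matrix (Fin p) (Fin q) ℝ) : ℝ :=
  ‖fun j => (WithLp.toLp 2 fun i => A i j : Vec p)‖

lemma colNorm_nonneg {p q : ℕ} (A : Matrix (Fin p) (Fin q) ℝ) : 0 ≤ colNorm A := norm_nonneg _

lemma colNorm_le_iff {p q : ℕ} {A : Matrix (Fin p) (Fin q) ℝ} {c : ℝ} (hc : 0 ≤ c) :
    colNorm A ≤ c ↔ ∀ j, ∑ i, A i j ^ 2 ≤ c ^ 2 := by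
  rw [colNorm, pi_norm_le_iff_of_nonneg hc]
  refine forall_congr' fun j => ?_
  rw [← pow_le_pow_iff_left₀ (norm_nonneg _) hc two_ne_zero, EuclideanSpace.real_norm_sq_eq]

lemma sum_sq_le_colNorm_sq {p q : ℕ} (A : Matrix (Fin p) (Fin q) ℝ) (j : Fin q) :
    ∑ i, A i j ^ 2 ≤ colNorm A ^ 2 :=
  (colNorm_le_iff (colNorm_nonneg A)).1 le_rfl j

lemma colNorm_le_of_sq_le {p q : ℕ} {A B : Matrix (Fin p) (Fin q) ℝ}
    (h : ∀ i j, A i j ^ 2 ≤ B i j ^ 2) : colNorm A ≤ colNorm B :=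
  (colNorm_le_iff (colNorm_nonneg B)).2 fun j =>
    (Finset.sum_le_sum fun i _ => h i j).trans (sum_sq_le_colNorm_sq B j)

lemma colNorm_le_specNorm {p q : ℕ} (A : Matrix (Fin p) (Fin q) ℝ) : colNorm A ≤ specNorm A := by
  rw [colNorm_le_iff (specNorm_nonneg A)]
  intro j
  have h := norm_toEuclideanLin_le A (EuclideanSpace.single j 1)
  simp only [PiLp.norm_single, norm_one, mul_one] at h
  have h2 := pow_le_pow_left₀ (norm_nonneg _) h 2
  rw [EuclideanSpace.real_norm_sq_eq] at h2
  simpa [toEuclideanLin_coord] using h2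

lemma eq_zero_of_colNorm_eq_zero {p q : ℕ} {A : Matrix (Fin p) (Fin q) ℝ} (h : colNorm A = 0) :
    A = 0 := by
  ext i j
  have h1 := sum_sq_le_colNorm_sq A j
  rw [h] at h1
  have h2 := (Finset.single_le_sum (f := fun i => A i j ^ 2) (fun _ _ => sq_nonneg _)
    (Finset.mem_univ i)).trans h1
  have h3 : A i j ^ 2 = 0 := le_antisymm (by simpa using h2) (sq_nonneg _)
  simpa using h3

lemma eq_zero_of_specNorm_eq_zero {p q : ℕ} {A : Matrix (Fin p) (Fin q) ℝ} (h : specNorm A = 0) :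
    A = 0 :=
  eq_zero_of_colNorm_eq_zero (le_antisymm (h ▸ colNorm_le_specNorm A) (colNorm_nonneg A))

/-! ### The network recursion and its gain -/

/-- The vectors `x`, `ψ₀(A₀ x)`, `ψ₁(A₁ ψ₀(A₀ x))`, … -/
noncomputable def act (w : Weights L n) (ψ : ∀ l : Fin L, Vec (n (l + 1)) → Vec (n (l + 1)))
    (x : Vec (n 0)) : ∀ l : ℕ, l ≤ L → Vec (n l)
  | 0, _ => x
  | l + 1, h => ψ ⟨l, h⟩ (Matrix.toEuclideanLin (layer w ⟨l, h⟩)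
      (act w ψ x l (Nat.le_of_succ_le h)))

/-- The activations, with the identity in the output layer. -/
def withOutputId (φ : ∀ l : Fin L, Vec (n (l + 1)) → Vec (n (l + 1))) :
    ∀ l : Fin L, Vec (n (l + 1)) → Vec (n (l + 1)) :=
  fun l => if (l : ℕ) + 1 < L then φ l else id

/-- `forward` activates just before the next matrix and `act` just after each matrix. The shift
makes every layer the same map, with the output layer covered by the identity. -/
lemma forward_succ_eq (w : Weights L n) (φ : ∀ l : Fin L, Vec (n (l + 1)) → Vec (n (l + 1)))
    (x : Vec (n 0)) : ∀ (l : ℕ) (h : l + 1 ≤ L), forward w φ x (l + 1) h =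
      Matrix.toEuclideanLin (layer w ⟨l, h⟩)
        (act w (withOutputId φ) x l (Nat.le_of_succ_le h))
  | 0, h => rfl
  | l + 1, h => by
    rw [forward, forward_succ_eq w φ x l, act, withOutputId, if_pos (by simpa using h)]

lemma output_eq_act (w : Weights L n) (φ : ∀ l : Fin L, Vec (n (l + 1)) → Vec (n (l + 1)))
    (x : Vec (n 0)) : output w φ x = act w (withOutputId φ) x L le_rfl := by
  cases L with
  | zero => rfl
  | succ L =>
    rw [output, forward_succ_eq, act, withOutputId, if_neg (by simp), id]

lemma lipschitzWith_withOutputId {φ : ∀ l : Fin L, Vec (n (l + 1)) → Vec (n (l + 1))}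
    {Lip : Fin L → ℝ≥0}
    (hφ : ∀ l : Fin L, (l : ℕ) + 1 < L → LipschitzWith (Lip l) (φ l) ∧ φ l 0 = 0)
    (hL : ∀ l : Fin L, (l : ℕ) + 1 = L → 1 ≤ Lip l) (l : Fin L) :
    LipschitzWith (Lip l) (withOutputId φ l) ∧ withOutputId φ l 0 = 0 := by
  unfold withOutputId
  split_ifs with h
  · exact hφ l h
  · exact ⟨LipschitzWith.id.weaken (hL l (by have := l.2; omega)), rfl⟩

/-- The layers with index less than `l`. -/
def before (L l : ℕ) : Finset (Fin L) := Finset.univ.filter fun k : Fin L => (k : ℕ) < l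

/-- `∏_{k < l} Lₖ ‖Aₖ‖`. -/
noncomputable def gain (Lip : Fin L → ℝ≥0) (w : Weights L n) (l : ℕ) : ℝ :=
  ∏ k ∈ before L l, (Lip k : ℝ) * specNorm (layer w k)

lemma mem_before {l : ℕ} {k : Fin L} : k ∈ before L l ↔ (k : ℕ) < l := by simp [before]

lemma before_zero : before L 0 = ∅ := by simp [before]

lemma before_last : before L L = Finset.univ := by
  ext k; simp [mem_before]

lemma before_succ {l : ℕ} (h : l < L) : before L (l + 1) = insert ⟨l, h⟩ (before L l) := by
  ext k
  simp only [mem_before, Finset.mem_insert, Fin.ext_iff]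
  omega

lemma gain_zero (Lip : Fin L → ℝ≥0) (w : Weights L n) : gain Lip w 0 = 1 := by simp [gain, before_zero]

lemma gain_succ (Lip : Fin L → ℝ≥0) (w : Weights L n) {l : ℕ} (h : l < L) :
    gain Lip w (l + 1) = Lip ⟨l, h⟩ * specNorm (layer w ⟨l, h⟩) * gain Lip w l := by
  rw [gain, before_succ h, Finset.prod_insert (by simp [mem_before]), gain]

lemma gain_nonneg (Lip : Fin L → ℝ≥0) (w : Weights L n) (l : ℕ) : 0 ≤ gain Lip w l :=
  Finset.prod_nonneg fun _ _ => mul_nonneg (NNReal.coe_nonneg _) (specNorm_nonneg _)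

lemma gain_last (Lip : Fin L → ℝ≥0) (w : Weights L n) :
    gain Lip w L = ∏ l : Fin L, (Lip l : ℝ) * specNorm (layer w l) := by
  rw [gain, before_last]

lemma layer_prune (w : Weights L n) (X : Coins L n) (l : Fin L) :
    layer (prune w X) l = layer w l - layer (removed w X) l := by
  rw [eq_sub_iff_add_eq]
  conv_rhs => rw [← prune_add_removed w X]
  rfl

lemma layer_prune_eq_zero {w : Weights L n} (X : Coins L n) {l : Fin L} (h : layer w l = 0) :
    layer (prune w X) l = 0 := by
  ext i j
  have h1 : w ⟨l, (i, j)⟩ = 0 := congrFun (congrFun h i) j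
  simp [layer, prune, h1]

/-! ### Deterministic propagation of the layer errors -/

section Deterministic

variable {ψ : ∀ l : Fin L, Vec (n (l + 1)) → Vec (n (l + 1))} {Lip : Fin L → ℝ≥0}

lemma norm_apply_le (hψ : ∀ l, LipschitzWith (Lip l) (ψ l) ∧ ψ l 0 = 0) (l : Fin L)
    (y : Vec (n (l + 1))) : ‖ψ l y‖ ≤ Lip l * ‖y‖ := by
  have := (hψ l).1.dist_le_mul y 0
  rwa [(hψ l).2, dist_zero_right, dist_zero_right] at this

/-- Accumulation of the errors of the layers. -/
lemma norm_act_prune_sub_le (hψ : ∀ l, LipschitzWith (Lip l) (ψ l) ∧ ψ l 0 = 0)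
    {w : Weights L n} {X : Coins L n} {x : Vec (n 0)} {M : ℝ} {g : Fin L → ℝ}
    (hM : 0 ≤ M) (hg : ∀ l, 0 ≤ g l)
    (h : ∀ l : Fin L, ‖Matrix.toEuclideanLin (layer (removed w X) l)
      (act (prune w X) ψ x l l.2.le)‖ ≤ M * g l * gain Lip w l) :
    ∀ (l : ℕ) (hl : l ≤ L), ‖act (prune w X) ψ x l hl - act w ψ x l hl‖ ≤
      M * gain Lip w l *
        ∑ k ∈ before L l, g k / specNorm (layer w k)
  | 0, _ => by simp [act, before_zero]
  | l + 1, hl => by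
    have ih := norm_act_prune_sub_le hψ hM hg h l (Nat.le_of_succ_le hl)
    have hl' := h ⟨l, hl⟩
    have hS : 0 ≤ ∑ k ∈ before L l, g k / specNorm (layer w k) :=
      Finset.sum_nonneg fun k _ => div_nonneg (hg k) (specNorm_nonneg _)
    rw [act, act, gain_succ Lip w hl, before_succ hl, Finset.sum_insert (by simp [mem_before])]
    set k : Fin L := ⟨l, hl⟩
    set u := act (prune w X) ψ x l (Nat.le_of_succ_le hl)
    set y := act w ψ x l (Nat.le_of_succ_le hl)
    set S := ∑ k ∈ before L l, g k / specNorm (layer w k)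
    have hG := gain_nonneg Lip w l
    -- If `A_k = 0`, division by its norm gives no information, but its pruned version vanishes too
    -- and both networks agree after this layer.
    rcases (specNorm_nonneg (layer w k)).eq_or_lt with h0 | h0
    · have hz := eq_zero_of_specNorm_eq_zero h0.symm
      rw [layer_prune_eq_zero X hz, hz]
      simp only [map_zero, LinearMap.zero_apply, sub_self, norm_zero]
      rw [← hz, ← h0]
      simp
    have h1 : ‖ψ k (Matrix.toEuclideanLin (layer (prune w X) k) u) -
        ψ k (Matrix.toEuclideanLin (layer w k) y)‖ ≤
        Lip k * ‖Matrix.toEuclideanLin (layer (prune w X) k) u -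
          Matrix.toEuclideanLin (layer w k) y‖ := by
      simpa [dist_eq_norm] using (hψ k).1.dist_le_mul
        (Matrix.toEuclideanLin (layer (prune w X) k) u) (Matrix.toEuclideanLin (layer w k) y)
    have h2 : Matrix.toEuclideanLin (layer (prune w X) k) u - Matrix.toEuclideanLin (layer w k) y =
        Matrix.toEuclideanLin (layer w k) (u - y) -
          Matrix.toEuclideanLin (layer (removed w X) k) u := by
      rw [layer_prune, map_sub, map_sub, LinearMap.sub_apply]
      abel
    have h3 : ‖Matrix.toEuclideanLin (layer (prune w X) k) u -
        Matrix.toEuclideanLin (layer w k) y‖ ≤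
        specNorm (layer w k) * (M * gain Lip w l * S) + M * g k * gain Lip w l := by
      rw [h2]
      refine (norm_sub_le _ _).trans (add_le_add ?_ hl')
      exact (norm_toEuclideanLin_le _ _).trans (mul_le_mul_of_nonneg_left ih h0.le)
    refine h1.trans ((mul_le_mul_of_nonneg_left h3 (NNReal.coe_nonneg _)).trans (le_of_eq ?_))
    change _ = M * (Lip k * specNorm (layer w k) * gain Lip w l) *
      (g k / specNorm (layer w k) + S)
    field_simp
    ring

/-- Each pruned matrix has norm at most `1 + c` times that of the original, so these factors
accumulate once per layer. -/
lemma norm_act_prune_le (hψ : ∀ l, LipschitzWith (Lip l) (ψ l) ∧ ψ l 0 = 0)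
    {w : Weights L n} {X : Coins L n} (x : Vec (n 0)) {c : ℝ} (hc : 0 ≤ c)
    (h : ∀ l : Fin L, specNorm (layer (removed w X) l) ≤ c * specNorm (layer w l)) :
    ∀ (l : ℕ) (hl : l ≤ L), ‖act (prune w X) ψ x l hl‖ ≤ (1 + c) ^ l * gain Lip w l * ‖x‖
  | 0, _ => by simp [act, gain_zero]
  | l + 1, hl => by
    have ih := norm_act_prune_le hψ x hc h l (Nat.le_of_succ_le hl)
    rw [act, gain_succ Lip w hl]
    set k : Fin L := ⟨l, hl⟩
    set u := act (prune w X) ψ x l (Nat.le_of_succ_le hl)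
    refine (norm_apply_le hψ k _).trans ?_
    have h1 : ‖Matrix.toEuclideanLin (layer (prune w X) k) u‖ ≤
        ((1 + c) * specNorm (layer w k)) * ‖u‖ := by
      rw [layer_prune, map_sub, LinearMap.sub_apply]
      refine (norm_sub_le _ _).trans ?_
      have a1 := norm_toEuclideanLin_le (layer w k) u
      have a2 := (norm_toEuclideanLin_le (layer (removed w X) k) u).trans
        (mul_le_mul_of_nonneg_right (h k) (norm_nonneg u))
      linarith
    have h2 := h1.trans (mul_le_mul_of_nonneg_left ih
      (mul_nonneg (by positivity) (specNorm_nonneg (layer w k))))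
    refine (mul_le_mul_of_nonneg_left h2 (NNReal.coe_nonneg _)).trans (le_of_eq ?_)
    ring

lemma one_add_inv_pow_le_exp {l : ℕ} (hl : l ≤ L) : (1 + 1 / (L : ℝ)) ^ l ≤ Real.exp 1 := by
  rcases Nat.eq_zero_or_pos L with h0 | h0
  · have : l = 0 := by omega
    subst this
    simp
  have hL : (0 : ℝ) < L := by exact_mod_cast h0
  calc (1 + 1 / (L : ℝ)) ^ l ≤ (Real.exp (1 / L)) ^ l := by
        refine pow_le_pow_left₀ (by positivity) ?_ l
        have := Real.add_one_le_exp (1 / (L : ℝ))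
        linarith
    _ = Real.exp (l * (1 / L)) := (Real.exp_nat_mul _ _).symm
    _ ≤ Real.exp 1 := by
        refine Real.exp_le_exp.2 ?_
        rw [mul_one_div, div_le_one hL]
        exact_mod_cast hl

end Deterministic

/-- The error bound for the output follows from bounds for the errors made in the layers. -/
lemma norm_output_sub_le_errorBound {φ : ∀ l : Fin L, Vec (n (l + 1)) → Vec (n (l + 1))}
    {Lip : Fin L → ℝ≥0} (hψ : ∀ l, LipschitzWith (Lip l) (withOutputId φ l) ∧ withOutputId φ l 0 = 0)
    {C : ℝ} (hC : 0 ≤ C) {d Ψ : ℝ≥0} {ε : Fin L → ℝ} (hε : ∀ l, 0 < ε l)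
    {w : Weights L n} {X : Coins L n} {x : Vec (n 0)}
    (h : ∀ l : Fin L, ‖Matrix.toEuclideanLin (layer (removed w X) l)
      (act (prune w X) (withOutputId φ) x l l.2.le)‖ ≤
        Real.exp 1 * n 0 * (ε l * Gam C d Ψ (n (l + 1)) (n l)) * gain Lip w l) :
    ‖output (prune w X) φ x - output w φ x‖ ≤ errorBound C d Ψ ε Lip w := by
  have key := norm_act_prune_sub_le hψ (by positivity)
    (fun l => mul_nonneg (hε l).le (Gam_nonneg hC _ _ _ _)) h L le_rfl
  rw [output_eq_act, output_eq_act, errorBound, ← gain_last]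
  rwa [before_last] at key

/-! ### Averages over random signs -/

section Rademacher

variable {ι : Type*} [Fintype ι] [DecidableEq ι]

lemma unit_cast_sq (u : ℤˣ) : ((u : ℤ) : ℝ) ^ 2 = 1 := by
  rcases Int.units_eq_one_or u with h | h <;> simp [h]

/-- Changing the sign at `a` permutes the sign patterns and negates the summand. -/
lemma sum_signs_mul_eq_zero {a b : ι} (h : a ≠ b) :
    ∑ t : ι → ℤˣ, ((t a : ℤ) : ℝ) * ((t b : ℤ) : ℝ) = 0 := by
  have h1 := Equiv.sum_comp (Equiv.mulLeft (Pi.mulSingle a (-1) : ι → ℤˣ))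
    (fun t : ι → ℤˣ => ((t a : ℤ) : ℝ) * ((t b : ℤ) : ℝ))
  simp only [Equiv.coe_mulLeft, Pi.mul_apply, Pi.mulSingle_eq_same,
    Pi.mulSingle_eq_of_ne h.symm, one_mul, neg_mul, Units.val_neg, Int.cast_neg,
    Finset.sum_neg_distrib] at h1
  linarith

/-- The second moment of a Rademacher sum. -/
lemma sum_signs_sq {κ : Type*} [Fintype κ] (e : κ → ι) (he : Function.Injective e) (c : κ → ℝ) :
    ∑ t : ι → ℤˣ, (∑ k, ((t (e k) : ℤ) : ℝ) * c k) ^ 2 =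
      Fintype.card (ι → ℤˣ) * ∑ k, c k ^ 2 := by
  have h1 : ∀ t : ι → ℤˣ, (∑ k, ((t (e k) : ℤ) : ℝ) * c k) ^ 2 =
      ∑ k, ∑ k', (((t (e k) : ℤ) : ℝ) * ((t (e k') : ℤ) : ℝ)) * (c k * c k') := by
    intro t
    rw [sq, Finset.sum_mul_sum]
    exact Finset.sum_congr rfl fun k _ => Finset.sum_congr rfl fun k' _ => by ring
  simp_rw [h1]
  rw [Finset.sum_comm, Finset.mul_sum]
  refine Finset.sum_congr rfl fun k _ => ?_
  rw [Finset.sum_comm, Finset.sum_eq_single k]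
  · simp_rw [← sq, unit_cast_sq, one_mul]
    simp
  · intro k' _ hk'
    rw [← Finset.sum_mul, sum_signs_mul_eq_zero (he.ne hk'.symm), zero_mul]
  · simp

end Rademacher

/-- Multiplication of the weights by signs. -/
def flip (s : Entry L n → ℤˣ) (w : Weights L n) : Weights L n := fun e => ((s e : ℤ) : ℝ) * w e

/-- The signs `s` on layer `k`, and `1` on the other layers. -/
def onLayer (k : Fin L) (s : Entry L n → ℤˣ) : Entry L n → ℤˣ := fun e => if e.1 = k then s e else 1

lemma flip_mul (s t : Entry L n → ℤˣ) (w : Weights L n) :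
    flip (s * t) w = flip s (flip t w) := by
  funext e; simp [flip, mul_assoc]

lemma flip_sq (s : Entry L n → ℤˣ) (w : Weights L n) (e : Entry L n) :
    flip s w e ^ 2 = w e ^ 2 := by
  simp [flip, mul_pow, unit_cast_sq]

lemma prune_flip (s : Entry L n → ℤˣ) (w : Weights L n) (X : Coins L n) :
    prune (flip s w) X = flip s (prune w X) := by
  funext e; simp [prune, flip]

lemma removed_flip (s : Entry L n → ℤˣ) (w : Weights L n) (X : Coins L n) :
    removed (flip s w) X = flip s (removed w X) := by
  funext e; simp only [removed, flip]; ring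

lemma layer_flip_onLayer_of_ne {k l : Fin L} (h : l ≠ k) (s : Entry L n → ℤˣ) (w : Weights L n) :
    layer (flip (onLayer k s) w) l = layer w l := by
  ext i j; simp [layer, flip, onLayer, h]

/-- This invariance is why column norms mediate between the pruned and the original network: the
spectral norm can change with the signs. -/
lemma colNorm_layer_flip (s : Entry L n → ℤˣ) (w : Weights L n) (l : Fin L) :
    colNorm (layer (flip s w) l) = colNorm (layer w l) :=
  le_antisymm (colNorm_le_of_sq_le fun _ _ => (flip_sq s w _).le)
    (colNorm_le_of_sq_le fun _ _ => (flip_sq s w _).ge)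

/-- Averaging over the signs of one layer. -/
lemma sum_flip_le_sum_flip (k : Fin L) {F G : Weights L n → ℝ}
    (h : ∀ w, ∑ t : Entry L n → ℤˣ, F (flip (onLayer k t) w) ≤
      Fintype.card (Entry L n → ℤˣ) * G w) (w : Weights L n) :
    ∑ s : Entry L n → ℤˣ, F (flip s w) ≤ ∑ s : Entry L n → ℤˣ, G (flip s w) := by
  have hcard : (0 : ℝ) < Fintype.card (Entry L n → ℤˣ) := by exact_mod_cast Fintype.card_pos
  refine le_of_mul_le_mul_left ?_ hcard
  -- Sign patterns form a group, so a further multiplication by signs on layer `k` leaves the full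
  -- sum unchanged. Here `t` runs over patterns on all layers; the redundant coordinates contribute
  -- the same factor on both sides.
  calc Fintype.card (Entry L n → ℤˣ) * ∑ s : Entry L n → ℤˣ, F (flip s w)
      = ∑ t : Entry L n → ℤˣ, ∑ s : Entry L n → ℤˣ, F (flip (onLayer k t * s) w) := by
        have : ∀ t : Entry L n → ℤˣ, ∑ s : Entry L n → ℤˣ, F (flip (onLayer k t * s) w) =
            ∑ s : Entry L n → ℤˣ, F (flip s w) := fun t =>
          Equiv.sum_comp (Equiv.mulLeft (onLayer k t)) fun s => F (flip s w)
        simp_rw [this]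
        simp
    _ = ∑ s : Entry L n → ℤˣ, ∑ t : Entry L n → ℤˣ, F (flip (onLayer k t) (flip s w)) := by
        rw [Finset.sum_comm]; simp_rw [flip_mul]
    _ ≤ ∑ s : Entry L n → ℤˣ, Fintype.card (Entry L n → ℤˣ) * G (flip s w) :=
        Finset.sum_le_sum fun s _ => h _
    _ = _ := (Finset.mul_sum _ _ _).symm

/-- Cauchy–Schwarz reduces to second moments. Orthogonality of the signs removes the cross terms,
leaving the squared column norms weighted by `v j ^ 2`. -/
lemma sum_norm_flip_le (k : Fin L) (w : Weights L n) (v : Vec (n k)) :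
    ∑ t : Entry L n → ℤˣ, ‖Matrix.toEuclideanLin (layer (flip (onLayer k t) w) k) v‖ ≤
      Fintype.card (Entry L n → ℤˣ) * (colNorm (layer w k) * ‖v‖) := by
  set N : ℝ := (Fintype.card (Entry L n → ℤˣ) : ℝ) with hN
  have hN0 : 0 ≤ N := Nat.cast_nonneg _
  refine le_of_sq_le_sq ?_ (by have := colNorm_nonneg (layer w k); positivity)
  have h1 : ∑ t : Entry L n → ℤˣ,
      ‖Matrix.toEuclideanLin (layer (flip (onLayer k t) w) k) v‖ ^ 2 ≤
      N * (colNorm (layer w k) ^ 2 * ‖v‖ ^ 2) := by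
    simp_rw [EuclideanSpace.real_norm_sq_eq, toEuclideanLin_coord]
    rw [Finset.sum_comm]
    have h2 : ∀ i, ∑ t : Entry L n → ℤˣ, (∑ j, layer (flip (onLayer k t) w) k i j * v j) ^ 2 =
        N * ∑ j, (layer w k i j * v j) ^ 2 := by
      intro i
      rw [hN, ← sum_signs_sq (fun j : Fin (n k) => (⟨k, (i, j)⟩ : Entry L n))
        (fun j j' h => by simpa using h)]
      simp [layer, flip, onLayer, mul_assoc]
    simp_rw [h2]
    rw [← Finset.mul_sum, Finset.sum_comm]
    refine mul_le_mul_of_nonneg_left ?_ hN0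
    rw [Finset.mul_sum]
    refine Finset.sum_le_sum fun j _ => ?_
    simp_rw [mul_pow]
    rw [← Finset.sum_mul]
    exact mul_le_mul_of_nonneg_right (sum_sq_le_colNorm_sq _ j) (sq_nonneg _)
  calc _ ≤ N * ∑ t : Entry L n → ℤˣ,
        ‖Matrix.toEuclideanLin (layer (flip (onLayer k t) w) k) v‖ ^ 2 := by
        simpa [hN] using sq_sum_le_card_mul_sum_sq (s := Finset.univ)
          (f := fun t : Entry L n → ℤˣ =>
            ‖Matrix.toEuclideanLin (layer (flip (onLayer k t) w) k) v‖)
    _ ≤ N * (N * (colNorm (layer w k) ^ 2 * ‖v‖ ^ 2)) := mul_le_mul_of_nonneg_left h1 hN0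
    _ = _ := by ring

/-! ### Sign averages of the relative errors -/

section

variable {ψ : ∀ l : Fin L, Vec (n (l + 1)) → Vec (n (l + 1))} {Lip : Fin L → ℝ≥0}

lemma act_congr {w w' : Weights L n} (x : Vec (n 0)) :
    ∀ (l : ℕ) (hl : l ≤ L), (∀ k : Fin L, (k : ℕ) < l → layer w k = layer w' k) →
      act w ψ x l hl = act w' ψ x l hl
  | 0, _, _ => rfl
  | l + 1, hl, h => by
    rw [act, act, act_congr x l _ fun k hk => h k (hk.trans (Nat.lt_succ_self l)),
      h ⟨l, hl⟩ (Nat.lt_succ_self l)]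

lemma gain_congr {w w' : Weights L n} {l : ℕ}
    (h : ∀ k : Fin L, (k : ℕ) < l → layer w k = layer w' k) : gain Lip w l = gain Lip w' l :=
  Finset.prod_congr rfl fun k hk => by rw [h k (mem_before.1 hk)]

lemma act_prune_flip_onLayer (w : Weights L n) (X : Coins L n) (x : Vec (n 0)) (k : Fin L)
    (t : Entry L n → ℤˣ) : act (prune (flip (onLayer k t) w) X) ψ x k k.2.le =
      act (prune w X) ψ x k k.2.le := by
  refine act_congr x _ _ fun j hj => ?_
  rw [prune_flip, layer_flip_onLayer_of_ne (fun h => by simp [h] at hj)]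

lemma gain_flip_onLayer (w : Weights L n) (k : Fin L) (t : Entry L n → ℤˣ) :
    gain Lip (flip (onLayer k t) w) k = gain Lip w k :=
  gain_congr fun j hj => layer_flip_onLayer_of_ne (fun h => by simp [h] at hj) _ _

lemma colNorm_layer_prune_le (w : Weights L n) (X : Coins L n) (k : Fin L) :
    colNorm (layer (prune w X) k) ≤ colNorm (layer w k) := by
  refine colNorm_le_of_sq_le fun i j => ?_
  simp only [layer, Matrix.of_apply, prune]
  split_ifs
  · simpa using sq_nonneg _
  · exact le_rfl

/-- On average over the signs of layer `k`, the pruned layer `k` does not increase the norm of its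
input by more than the factor `Lₖ ‖Aₖ‖`. -/
lemma sum_norm_act_succ_div_gain_le (hψ : ∀ l, LipschitzWith (Lip l) (ψ l) ∧ ψ l 0 = 0)
    (w : Weights L n) (X : Coins L n) (x : Vec (n 0)) (k : Fin L) :
    ∑ t : Entry L n → ℤˣ, ‖act (prune (flip (onLayer k t) w) X) ψ x (k + 1) k.2‖ /
        gain Lip (flip (onLayer k t) w) (k + 1) ≤
      Fintype.card (Entry L n → ℤˣ) * (‖act (prune w X) ψ x k k.2.le‖ / gain Lip w k) := by
  set u := act (prune w X) ψ x k k.2.le with hu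
  set c := colNorm (layer w k) with hc
  have hc0 : 0 ≤ c := colNorm_nonneg _
  have hG0 : 0 ≤ gain Lip w k := gain_nonneg _ _ _
  have h1 : ∀ t : Entry L n → ℤˣ, ‖act (prune (flip (onLayer k t) w) X) ψ x (k + 1) k.2‖ /
        gain Lip (flip (onLayer k t) w) (k + 1) ≤
      ‖Matrix.toEuclideanLin (layer (flip (onLayer k t) (prune w X)) k) u‖ *
        (c⁻¹ * (gain Lip w k)⁻¹) := by
    intro t
    rw [act, gain_succ Lip _ k.2]
    simp only [Fin.eta]
    rw [act_prune_flip_onLayer, gain_flip_onLayer, prune_flip, ← hu]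
    set y := Matrix.toEuclideanLin (layer (flip (onLayer k t) (prune w X)) k) u
    have hca : c ≤ specNorm (layer (flip (onLayer k t) w) k) := by
      rw [hc, ← colNorm_layer_flip (onLayer k t)]; exact colNorm_le_specNorm _
    have hy := norm_apply_le hψ k y
    -- The three degenerate cases, zero column norm, zero Lipschitz constant and zero earlier gain,
    -- are those where a quotient has the default value 0.
    rcases hc0.eq_or_lt with hc0' | hc0'
    · have hz' : colNorm (layer (flip (onLayer k t) (prune w X)) k) = 0 := by
        rw [colNorm_layer_flip]
        exact le_antisymm ((colNorm_layer_prune_le w X k).trans hc0'.ge) (colNorm_nonneg _)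
      have hy0 : y = 0 := by
        simp only [y]; rw [eq_zero_of_colNorm_eq_zero hz']; simp
      rw [hy0, (hψ k).2]
      simp
    rcases (NNReal.coe_nonneg (Lip k)).eq_or_lt with hl | hl
    · rw [← hl]; simp; positivity
    rcases hG0.eq_or_lt with hg | hg
    · rw [← hg]; simp
    rw [← mul_inv, ← div_eq_mul_inv]
    rw [div_le_div_iff₀ (mul_pos (mul_pos hl (hc0'.trans_le hca)) hg) (mul_pos hc0' hg)]
    calc ‖ψ k y‖ * (c * gain Lip w k) ≤
          (Lip k * ‖y‖) * (specNorm (layer (flip (onLayer k t) w) k) * gain Lip w k) := by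
          gcongr
      _ = _ := by ring
  refine (Finset.sum_le_sum fun t _ => h1 t).trans ?_
  rw [← Finset.sum_mul]
  refine (mul_le_mul_of_nonneg_right (sum_norm_flip_le k (prune w X) u)
    (by positivity)).trans ?_
  rw [mul_assoc]
  refine mul_le_mul_of_nonneg_left ?_ (Nat.cast_nonneg _)
  have h2 : colNorm (layer (prune w X) k) * c⁻¹ ≤ 1 := by
    rw [← div_eq_mul_inv]
    exact div_le_one_of_le₀ (colNorm_layer_prune_le w X k) hc0
  calc colNorm (layer (prune w X) k) * ‖u‖ * (c⁻¹ * (gain Lip w k)⁻¹) =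
        (colNorm (layer (prune w X) k) * c⁻¹) * (‖u‖ / gain Lip w k) := by ring
    _ ≤ 1 * (‖u‖ / gain Lip w k) := mul_le_mul_of_nonneg_right h2 (by positivity)
    _ = _ := one_mul _

/-- Layers are peeled off from the last to the first, averaging over the signs of one layer each
time. The column norm of the removed part does not depend on the signs and acts as a constant
throughout. -/
lemma sum_flip_colNorm_mul_act_le (hψ : ∀ l, LipschitzWith (Lip l) (ψ l) ∧ ψ l 0 = 0)
    (w : Weights L n) (X : Coins L n) (x : Vec (n 0)) (l : Fin L) :
    ∀ (k : ℕ) (hk : k ≤ l), ∑ s : Entry L n → ℤˣ,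
      colNorm (layer (removed (flip s w) X) l) *
        (‖act (prune (flip s w) X) ψ x k (hk.trans l.2.le)‖ / gain Lip (flip s w) k) ≤
      ∑ s : Entry L n → ℤˣ, colNorm (layer (removed (flip s w) X) l) * ‖x‖
  | 0, _ => by simp [act, gain_zero]
  | k + 1, hk => by
    have hkL : k < L := (Nat.lt_of_succ_le hk).trans l.2
    have ih := sum_flip_colNorm_mul_act_le hψ w X x l k (Nat.le_of_succ_le hk)
    refine le_trans (sum_flip_le_sum_flip ⟨k, hkL⟩
      (F := fun w => colNorm (layer (removed w X) l) *
        (‖act (prune w X) ψ x (k + 1) (hk.trans l.2.le)‖ / gain Lip w (k + 1)))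
      (G := fun w => colNorm (layer (removed w X) l) *
        (‖act (prune w X) ψ x k (Nat.le_of_succ_le (hk.trans l.2.le))‖ / gain Lip w k))
      (fun w => ?_) w) ih
    simp_rw [removed_flip, colNorm_layer_flip]
    rw [← Finset.mul_sum, mul_left_comm]
    exact mul_le_mul_of_nonneg_left (sum_norm_act_succ_div_gain_le hψ w X x ⟨k, hkL⟩)
      (colNorm_nonneg _)

/-- On average over all signs, the relative error made in layer `l` is at most the norm of the
removed weights of this layer times the norm of the input. -/
lemma sum_flip_error_div_gain_le (hψ : ∀ l, LipschitzWith (Lip l) (ψ l) ∧ ψ l 0 = 0)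
    (w : Weights L n) (X : Coins L n) (x : Vec (n 0)) (l : Fin L) :
    ∑ s : Entry L n → ℤˣ, ‖Matrix.toEuclideanLin (layer (removed (flip s w) X) l)
        (act (prune (flip s w) X) ψ x l l.2.le)‖ / gain Lip (flip s w) l ≤
      ∑ s : Entry L n → ℤˣ, specNorm (layer (removed (flip s w) X) l) * ‖x‖ := by
  -- The signs of layer `l` come first: its input and the gain before it depend only on earlier
  -- layers, so only the removed matrix is re-signed.
  refine (sum_flip_le_sum_flip l
    (F := fun w => ‖Matrix.toEuclideanLin (layer (removed w X) l)
        (act (prune w X) ψ x l l.2.le)‖ / gain Lip w l)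
    (G := fun w => colNorm (layer (removed w X) l) *
        (‖act (prune w X) ψ x l l.2.le‖ / gain Lip w l)) (fun w => ?_) w).trans
    ((sum_flip_colNorm_mul_act_le hψ w X x l l le_rfl).trans
      (Finset.sum_le_sum fun s _ =>
        mul_le_mul_of_nonneg_right (colNorm_le_specNorm _) (norm_nonneg _)))
  simp_rw [act_prune_flip_onLayer, gain_flip_onLayer, removed_flip]
  rw [← Finset.sum_div, ← mul_div_assoc, ← mul_div_assoc]
  exact div_le_div_of_nonneg_right (sum_norm_flip_le l (removed w X) _) (gain_nonneg _ _ _)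

end

/-! ### Sign invariance of the joint law -/

lemma measurable_flip (s : Entry L n → ℤˣ) : Measurable (flip (L := L) (n := n) s) :=
  measurable_pi_lambda _ fun e => (measurable_pi_apply e).const_mul _

lemma map_flip_weightLaw (s : Entry L n → ℤˣ) (Ψ : ℝ≥0) :
    (weightLaw L n Ψ).map (flip s) = weightLaw L n Ψ := by
  have h1 : ∀ e, (gaussianReal 0 Ψ).map (fun a : ℝ => ((s e : ℤ) : ℝ) * a) = gaussianReal 0 Ψ := by
    intro e
    rcases Int.units_eq_one_or (s e) with h | h
    · simp [h]
    · simp [h, gaussianReal_map_neg]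
  have : ∀ e, SigmaFinite ((gaussianReal 0 Ψ).map (fun a : ℝ => ((s e : ℤ) : ℝ) * a)) := fun e => by
    rw [h1]; infer_instance
  have h2 := Measure.pi_map_pi (μ := fun _ : Entry L n => gaussianReal 0 Ψ)
    (f := fun e (a : ℝ) => ((s e : ℤ) : ℝ) * a) (fun e => by fun_prop)
  simp_rw [h1] at h2
  exact h2

lemma coinLaw_flip (d Ψ : ℝ≥0) (s : Entry L n → ℤˣ) (w : Weights L n) :
    coinLaw d Ψ (flip s w) = coinLaw d Ψ w := by
  unfold coinLaw
  congr 1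
  funext e
  congr 1
  simp only [pruneProb, flip_sq]

/-- The joint law is invariant under changes of the signs of the weights. -/
lemma lintegral_jointLaw_flip (d Ψ : ℝ≥0) (s : Entry L n → ℤˣ)
    {F : Weights L n × Coins L n → ℝ≥0∞} (hF : Measurable F) :
    ∫⁻ p, F (flip s p.1, p.2) ∂jointLaw L n d Ψ = ∫⁻ p, F p ∂jointLaw L n d Ψ := by
  have hm : Measurable fun p : Weights L n × Coins L n => (flip s p.1, p.2) :=
    ((measurable_flip s).comp measurable_fst).prodMk measurable_snd
  have hin : Measurable fun w => ∫⁻ X, F (w, X) ∂coinKernel L n d Ψ w :=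
    hF.lintegral_kernel_prod_right'
  rw [jointLaw, Measure.lintegral_compProd (f := fun p => F (flip s p.1, p.2)) (hF.comp hm),
    Measure.lintegral_compProd hF]
  conv_rhs => rw [← map_flip_weightLaw s Ψ, lintegral_map hin (measurable_flip s)]
  refine lintegral_congr fun w => ?_
  change ∫⁻ X, F (flip s w, X) ∂coinLaw d Ψ w = ∫⁻ X, F (flip s w, X) ∂coinLaw d Ψ (flip s w)
  rw [coinLaw_flip]

/-! ### Markov's inequality and the union bound -/

/-- Markov's inequality. -/
lemma measure_lt_le_inv {Ω : Type*} [MeasurableSpace Ω] {μ : Measure Ω} {Z : Ω → ℝ}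
    (hZ : Measurable Z) {g ε : ℝ} (hg : 0 ≤ g) (hε : 0 < ε)
    (h : ∫⁻ ω, ENNReal.ofReal (Z ω) ∂μ ≤ ENNReal.ofReal g) :
    μ {ω | ε * g < Z ω} ≤ ENNReal.ofReal ε⁻¹ := by
  rcases hg.eq_or_lt with h0 | h0
  -- For `g = 0` the Markov quotient is unusable, but the integral vanishes and hence `Z ≤ 0` almost
  -- surely.
  · rw [← h0, ENNReal.ofReal_zero, nonpos_iff_eq_zero,
      lintegral_eq_zero_iff hZ.ennreal_ofReal] at h
    have : μ {ω | ε * g < Z ω} = 0 := by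
      rw [← h0, mul_zero]
      refine measure_mono_null (fun ω hω => ?_) h
      simpa using hω
    simp [this]
  · calc μ {ω | ε * g < Z ω} ≤ μ {ω | ENNReal.ofReal (ε * g) ≤ ENNReal.ofReal (Z ω)} :=
          measure_mono fun ω hω => ENNReal.ofReal_le_ofReal (le_of_lt hω)
      _ ≤ (∫⁻ ω, ENNReal.ofReal (Z ω) ∂μ) / ENNReal.ofReal (ε * g) :=
          meas_ge_le_lintegral_div hZ.ennreal_ofReal.aemeasurable
            (by simpa using mul_pos hε h0) ENNReal.ofReal_ne_top
      _ ≤ ENNReal.ofReal g / ENNReal.ofReal (ε * g) := ENNReal.div_le_div_right h _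
      _ = ENNReal.ofReal ε⁻¹ := by
          rw [← ENNReal.ofReal_div_of_pos (mul_pos hε h0)]
          congr 1
          field_simp

/-- Markov's inequality together with a union bound. -/
lemma one_sub_sum_inv_le_measureReal {Ω ι : Type*} [Fintype ι] [MeasurableSpace Ω] {μ : Measure Ω}
    [IsProbabilityMeasure μ] {Z : ι → Ω → ℝ} (hZ : ∀ l, Measurable (Z l)) {g ε : ι → ℝ}
    (hg : ∀ l, 0 ≤ g l) (hε : ∀ l, 0 < ε l)
    (h : ∀ l, ∫⁻ ω, ENNReal.ofReal (Z l ω) ∂μ ≤ ENNReal.ofReal (g l)) {S : Set Ω}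
    (hS : ∀ ω, (∀ l, Z l ω ≤ ε l * g l) → ω ∈ S) :
    1 - ∑ l, (ε l)⁻¹ ≤ μ.real S := by
  -- Only subadditivity is applied to this cover, so `S` need not be measurable; this matters for
  -- the event quantified over all inputs.
  have h1 : (Set.univ : Set Ω) ⊆ S ∪ ⋃ l, {ω | ε l * g l < Z l ω} := by
    intro ω _
    by_cases hω : ∀ l, Z l ω ≤ ε l * g l
    · exact Or.inl (hS ω hω)
    · push Not at hω
      obtain ⟨l, hl⟩ := hω
      exact Or.inr (Set.mem_iUnion.2 ⟨l, hl⟩)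
  have h2 : μ.real (⋃ l, {ω | ε l * g l < Z l ω}) ≤ ∑ l, (ε l)⁻¹ :=
    (measureReal_iUnion_fintype_le _).trans (Finset.sum_le_sum fun l _ =>
      ENNReal.toReal_le_of_le_ofReal (inv_pos.2 (hε l)).le
        (measure_lt_le_inv (hZ l) (hg l) (hε l) (h l)))
  have h3 := (measureReal_mono (μ := μ) h1).trans (measureReal_union_le _ _)
  rw [probReal_univ] at h3
  linarith

/-! ### Measurability and the expected relative error -/

section

variable {ψ : ∀ l : Fin L, Vec (n (l + 1)) → Vec (n (l + 1))} {Lip : Fin L → ℝ≥0}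

lemma continuous_toEuclideanLin_apply {Ω : Type*} [TopologicalSpace Ω] {p q : ℕ}
    {A : Ω → Matrix (Fin p) (Fin q) ℝ} {v : Ω → Vec q} (hA : Continuous A) (hv : Continuous v) :
    Continuous fun ω => Matrix.toEuclideanLin (A ω) (v ω) := by
  simp only [Matrix.toLpLin_apply]
  fun_prop

lemma continuous_prune (X : Coins L n) : Continuous fun w : Weights L n => prune w X := by
  refine continuous_pi fun e => ?_
  unfold prune
  split_ifs
  · exact continuous_const
  · exact continuous_apply e

lemma continuous_act (hψ : ∀ l, Continuous (ψ l)) (x : Vec (n 0)) :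
    ∀ (l : ℕ) (hl : l ≤ L), Continuous fun w : Weights L n => act w ψ x l hl
  | 0, _ => continuous_const
  | l + 1, _ => (hψ _).comp (continuous_toEuclideanLin_apply (continuous_layer _)
      (continuous_act hψ x l _))

lemma continuous_gain (l : ℕ) : Continuous fun w : Weights L n => gain Lip w l :=
  continuous_finsetProd _ fun k _ =>
    continuous_const.mul (continuous_specNorm.comp (continuous_layer k))

lemma measurable_specNorm_removed (l : Fin L) :
    Measurable fun p : Weights L n × Coins L n => specNorm (layer (removed p.1 p.2) l) :=
  measurable_of_continuous_weights fun X =>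
    continuous_specNorm.comp ((continuous_layer l).comp (continuous_removed X))

lemma measurable_error_div_gain (hψ : ∀ l, Continuous (ψ l)) (x : Vec (n 0)) (l : Fin L) :
    Measurable fun p : Weights L n × Coins L n =>
      ‖Matrix.toEuclideanLin (layer (removed p.1 p.2) l)
        (act (prune p.1 p.2) ψ x l l.2.le)‖ / gain Lip p.1 l := by
  refine (measurable_of_continuous_weights fun X => ?_).div
    (measurable_of_continuous_weights fun X => continuous_gain l)
  exact (continuous_toEuclideanLin_apply ((continuous_layer l).comp (continuous_removed X))
    ((continuous_act hψ x l _).comp (continuous_prune X))).norm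

/-- When the gain is 0, a bound on the quotient error / gain is void; the error itself then
vanishes. -/
lemma act_prune_eq_zero_of_gain_eq_zero (hψ : ∀ l, LipschitzWith (Lip l) (ψ l) ∧ ψ l 0 = 0)
    {w : Weights L n} (X : Coins L n) (x : Vec (n 0)) :
    ∀ (l : ℕ) (hl : l ≤ L), gain Lip w l = 0 → act (prune w X) ψ x l hl = 0
  | 0, _, h => by simp [gain_zero] at h
  | l + 1, hl, h => by
    rw [gain_succ Lip w hl, mul_eq_zero, mul_eq_zero] at h
    rw [act, ← norm_le_zero_iff]
    refine (norm_apply_le hψ _ _).trans (le_of_eq ?_)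
    rcases h with (h | h) | h
    · rw [h, zero_mul]
    · rw [layer_prune_eq_zero X (eq_zero_of_specNorm_eq_zero h)]
      simp
    · rw [act_prune_eq_zero_of_gain_eq_zero hψ X x l _ h]
      simp

/-- The expected relative error made in a layer. -/
lemma lintegral_error_div_gain_le (hψ : ∀ l, LipschitzWith (Lip l) (ψ l) ∧ ψ l 0 = 0)
    {d Ψ : ℝ≥0} (hd : 0 < d) (hΨ : 0 < Ψ) {x : Vec (n 0)} (hx : ‖x‖ ≤ n 0) (l : Fin L) :
    ∫⁻ p, ENNReal.ofReal (‖Matrix.toEuclideanLin (layer (removed p.1 p.2) l)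
        (act (prune p.1 p.2) ψ x l l.2.le)‖ / gain Lip p.1 l) ∂jointLaw L n d Ψ ≤
      ENNReal.ofReal (n 0 * Gam 3 d Ψ (n (l + 1)) (n l)) := by
  set Z : Weights L n × Coins L n → ℝ := fun p =>
    ‖Matrix.toEuclideanLin (layer (removed p.1 p.2) l)
        (act (prune p.1 p.2) ψ x l l.2.le)‖ / gain Lip p.1 l with hZ
  set Y : Weights L n × Coins L n → ℝ := fun p => specNorm (layer (removed p.1 p.2) l) * ‖x‖
    with hY
  have hZm : Measurable Z := measurable_error_div_gain (fun l => (hψ l).1.continuous) x l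
  have hYm : Measurable Y := (measurable_specNorm_removed l).mul_const _
  have hZ0 : ∀ p, 0 ≤ Z p := fun p => div_nonneg (norm_nonneg _) (gain_nonneg _ _ _)
  have hY0 : ∀ p, 0 ≤ Y p := fun p => mul_nonneg (specNorm_nonneg _) (norm_nonneg _)
  have hflip : ∀ s : Entry L n → ℤˣ, Measurable fun p : Weights L n × Coins L n =>
      (flip s p.1, p.2) := fun s =>
    ((measurable_flip s).comp measurable_fst).prodMk measurable_snd
  -- By invariance each sign pattern contributes the same integral, so the pointwise comparison of
  -- sign sums becomes a comparison of expectations.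
  have hsum : ∀ {U : Weights L n × Coins L n → ℝ}, Measurable U → (∀ p, 0 ≤ U p) →
      ∫⁻ p, ENNReal.ofReal (∑ s : Entry L n → ℤˣ, U (flip s p.1, p.2)) ∂jointLaw L n d Ψ =
      (Fintype.card (Entry L n → ℤˣ) : ℝ≥0∞) * ∫⁻ p, ENNReal.ofReal (U p) ∂jointLaw L n d Ψ := by
    intro U hU hU0
    simp_rw [ENNReal.ofReal_sum_of_nonneg fun s _ => hU0 _]
    have hUm : ∀ s : Entry L n → ℤˣ, Measurable fun p : Weights L n × Coins L n =>
        ENNReal.ofReal (U (flip s p.1, p.2)) := fun s => (hU.comp (hflip s)).ennreal_ofReal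
    rw [lintegral_finsetSum _ fun s _ => hUm s]
    have : ∀ s : Entry L n → ℤˣ, ∫⁻ p, ENNReal.ofReal (U (flip s p.1, p.2)) ∂jointLaw L n d Ψ =
        ∫⁻ p, ENNReal.ofReal (U p) ∂jointLaw L n d Ψ := fun s =>
      lintegral_jointLaw_flip d Ψ s hU.ennreal_ofReal
    simp_rw [this]
    simp
  have hle : (Fintype.card (Entry L n → ℤˣ) : ℝ≥0∞) *
      ∫⁻ p, ENNReal.ofReal (Z p) ∂jointLaw L n d Ψ ≤
      (Fintype.card (Entry L n → ℤˣ) : ℝ≥0∞) * ∫⁻ p, ENNReal.ofReal (Y p) ∂jointLaw L n d Ψ := by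
    rw [← hsum hZm hZ0, ← hsum hYm hY0]
    exact lintegral_mono fun p => ENNReal.ofReal_le_ofReal
      (sum_flip_error_div_gain_le hψ p.1 p.2 x l)
  have hcard : (Fintype.card (Entry L n → ℤˣ) : ℝ≥0∞) ≠ 0 := by
    exact_mod_cast Fintype.card_ne_zero
  have hle' := (ENNReal.mul_le_mul_iff_right hcard (ENNReal.natCast_ne_top _)).1 hle
  refine hle'.trans ?_
  simp only [hY]
  simp_rw [ENNReal.ofReal_mul (specNorm_nonneg _)]
  rw [lintegral_mul_const _ (measurable_specNorm_removed l).ennreal_ofReal, mul_comm,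
    ENNReal.ofReal_mul (Nat.cast_nonneg _)]
  exact mul_le_mul' (ENNReal.ofReal_le_ofReal hx) (lintegral_specNorm_removed_le hd hΨ l)

end

end MBP

/-! ### The main theorem -/

theorem mainTheorem5 :
    ∃ C : ℝ, 0 < C ∧
      ∀ (L : ℕ) (n : ℕ → ℕ) (d Ψ : ℝ≥0), 0 < d → 0 < Ψ →
      ∀ (Lip : Fin L → ℝ≥0) (φ : ∀ l : Fin L, MBP.Vec (n (l + 1)) → MBP.Vec (n (l + 1))),
        (∀ l : Fin L, (l : ℕ) + 1 < L → LipschitzWith (Lip l) (φ l) ∧ φ l 0 = 0) →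
        -- the output layer has no activation, i.e. the identity
        (∀ l : Fin L, (l : ℕ) + 1 = L → 1 ≤ Lip l) →
      ∀ ε : Fin L → ℝ, (∀ l, 0 < ε l) →
        -- for every input of norm at most the input dimension
        (∀ x : MBP.Vec (n 0), ‖x‖ ≤ (n 0 : ℝ) →
          1 - ∑ l, (ε l)⁻¹ ≤ (MBP.jointLaw L n d Ψ).real
            {p | ‖MBP.output (MBP.prune p.1 p.2) φ x - MBP.output p.1 φ x‖ ≤
              MBP.errorBound C d Ψ ε Lip p.1}) ∧
        -- simultaneously for all such inputs, where the perturbation condition is met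
        1 - ∑ l, (ε l)⁻¹ ≤ (MBP.jointLaw L n d Ψ).real
          {p | (∀ l : Fin L, ε l * MBP.Gam C d Ψ (n (l + 1)) (n l) ≤
                  1 / (L : ℝ) * MBP.specNorm (MBP.layer p.1 l)) →
            ∀ x : MBP.Vec (n 0), ‖x‖ ≤ (n 0 : ℝ) →
              ‖MBP.output (MBP.prune p.1 p.2) φ x - MBP.output p.1 φ x‖ ≤
                MBP.errorBound C d Ψ ε Lip p.1} := by
  -- The constant is `3/2 * 2`: the first factor from the choice of `lam`, the second from `sqrt (4
  -- * s * r)`.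
  refine ⟨3, by norm_num, ?_⟩
  intro L n d Ψ hd hΨ Lip φ hφ hL ε hε
  have hψ := MBP.lipschitzWith_withOutputId hφ hL
  have hΓ : ∀ l : Fin L, 0 ≤ MBP.Gam 3 d Ψ (n (l + 1)) (n l) := fun l =>
    MBP.Gam_nonneg (by norm_num) _ _ _ _
  constructor
  · intro x hx
    refine MBP.one_sub_sum_inv_le_measureReal
      (fun l => MBP.measurable_error_div_gain (fun l => (hψ l).1.continuous) x l)
      (fun l => mul_nonneg (Nat.cast_nonneg _) (hΓ l)) hε
      (fun l => MBP.lintegral_error_div_gain_le hψ hd hΨ hx l) fun p hp => ?_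
    refine MBP.norm_output_sub_le_errorBound hψ (by norm_num) hε fun l => ?_
    have hG := MBP.gain_nonneg Lip p.1 l
    rcases hG.eq_or_lt with hG0 | hG0
    · rw [MBP.act_prune_eq_zero_of_gain_eq_zero hψ p.2 x l l.2.le hG0.symm, ← hG0]
      simp
    · have h1 := (div_le_iff₀ hG0).1 (hp l)
      refine h1.trans (mul_le_mul_of_nonneg_right ?_ hG)
      have h2 : 0 ≤ (n 0 : ℝ) * (ε l * MBP.Gam 3 d Ψ (n (l + 1)) (n l)) :=
        mul_nonneg (Nat.cast_nonneg _) (mul_nonneg (hε l).le (hΓ l))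
      -- For a fixed input the sign average involves no loss, so the factor `e` is slack.
      have h3 := le_mul_of_one_le_left h2 (Real.one_le_exp zero_le_one)
      linarith
  · refine MBP.one_sub_sum_inv_le_measureReal
      (fun l => MBP.measurable_specNorm_removed l) hΓ hε
      (fun l => MBP.lintegral_specNorm_removed_le hd hΨ l) fun p hp hcond x hx => ?_
    refine MBP.norm_output_sub_le_errorBound hψ (by norm_num) hε fun l => ?_
    have hG := MBP.gain_nonneg Lip p.1 l
    -- On the good event the perturbation condition gives relative size `c = 1 / L` for every
    -- removed part, and the accumulated factor stays below `e`.
    have h1 := MBP.norm_act_prune_le hψ x (by positivity)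
      (fun k => (hp k).trans (hcond k)) l l.2.le
    have h2 : (1 + 1 / (L : ℝ)) ^ (l : ℕ) * MBP.gain Lip p.1 l * ‖x‖ ≤
        Real.exp 1 * MBP.gain Lip p.1 l * n 0 :=
      mul_le_mul (mul_le_mul_of_nonneg_right (MBP.one_add_inv_pow_le_exp l.2.le) hG) hx
        (norm_nonneg _) (by positivity)
    refine (MBP.norm_toEuclideanLin_le _ _).trans ((mul_le_mul (hp l) (h1.trans h2)
      (norm_nonneg _) (mul_nonneg (hε l).le (hΓ l))).trans (le_of_eq ?_))
    ring
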